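/- **Model.** A literal is a Boolean variable or its negation, and a clause is a disjunction of literals of distinct variables. Let $n=B\cdot h$ and let the variables $v_1,\dots,v_n$ be divided into $B$ communities of $h$ consecutive variables each. For a tuple $\mathbf K=(k_1,\dots,k_\ell)$, $\ell\ge1$, of positive integers in non-increasing order, $\Omega_B(n,\mathbf K)$ is the set of clauses of length $k_1+\dots+k_\ell$ that, for some mutually distinct communities $\mathcal C_{i_1},\dots,\mathcal C_{i_\ell}$, contain exactly $k_j$ variables of $\mathcal C_{i_j}$ for each $j$; $P_{\mathbf K}$ is the uniform measure on it. Fix mutually distinct clause types $\mathbf K_1,\dots,\mathbf K_T$ and numbers $p_1,\dots,p_T\ge 0$ with $\sum_t p_t=1$, and let $P=\sum_{t}p_tP_{\mathbf K_t}$. A random instance in $F(n,m,B,P)$ is a conjunction of $m$ independent clauses, each drawn from $P$. The types $\mathbf K_t$ and weights $p_t$ do not depend on $n$, while $B=B(n)$, $h=h(n)=n/B$ and $m=m(n)$ may; $n\to\infty$ along an arbitrary sequence of values, and $h$ is always at least every entry of every $\mathbf K_t$ and $B$ at least the number of entries of every $\mathbf K_t$. "W.h.p." means with probability tending to $1$ as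 $n\to\infty$, and "bounded away" from a value means bounded away from it for all sufficiently large $n$. We write $f=\Omega(g)$ for $g=O(f)$ and $f=\omega(g)$ for $g=o(f)$. For $k\ge2$, $r_k^*$ is the infimum of all $\alpha$ such that a random $k$-SAT instance with $n$ variables and density $\alpha$, that is, with $\lfloor\alpha n\rfloor$ clauses chosen independently and uniformly from the $\binom nk2^k$ clauses of length $k$, is UNSAT w.h.p. **Theorem.** Let $\mathcal I$ be a random instance in $F(n,m(n),B,P)$, where $\mathbf K_t=(k)$ and $p_t>0$ for some $1\le t\le T$ and some $k\ge1$. (a) Let $h(n)=O(1)$. (i) If $T=1$ (so that $P=P_{(k)}$) and $m(n)=o(n^{1-1/2^k})$, then $\mathcal I$ is SAT w.h.p. (ii) If $m(n)=\Theta(n^{1-1/2^k})$, then $\mathcal I$ is SAT with probability bounded away from $1$. If, moreover, $T=1$, then $\mathcal I$ is SAT with probability bounded away from both $0$ and $1$. (iii) If $m(n)=\omega(n^{1-1/2^k})$, then $\mathcal I$ is UNSAT w.h.p. (b) If $h(n)=o\left(\frac{\ln n}{\ln\ln n}\right)$ and $m(n)=\Omega\left(n/\ln^\theta n\right)$ for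 some $\theta$, then $\mathcal I$ is UNSAT w.h.p. (c) Let $k\ge2$. If $h(n)=o(\ln n)$ and $m(n)=\Omega\left(n\cdot e^{-\beta\ln n/h(n)}\right)$ for some $\beta<1/r_k^*$ such that $2^k\beta<h(n)$ for all sufficiently large $n$ (which holds automatically if $h(n)\to\infty$), then $\mathcal I$ is UNSAT w.h.p. (d) Let $k\ge2$, $h(n)=O(\ln n)$ and $T=1$. Then there exists some $\varepsilon_0>0$, depending only on $k$ and on the implicit constant in $h(n)=O(\ln n)$, such that, if $m(n)=\alpha n$ (rounded to an integer in either direction) with $\alpha>r_k^*-\varepsilon_0$, then $\mathcal I$ is UNSAT w.h.p. -/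

import Mathlib

open MeasureTheory ProbabilityTheory Filter Topology Asymptotics

/-- A literal over the variable set `V`: `(v, true)` is the variable `v` and `(v, false)` is its
negation. -/
abbrev Literal (V : Type) := V × Bool

/-- A clause is the disjunction of a finite set of literals. -/
abbrev Clause (V : Type) := Finset (Literal V)

/-- The literals of the clause involve mutually distinct variables. -/
def HasDistinctVars {V : Type} (c : Clause V) : Prop :=
  Set.InjOn Prod.fst (c : Set (Literal V))

/-- The formula `F 0 ∧ ⋯ ∧ F (m - 1)` is satisfiable: some truth assignment makes at least one
literal of each clause true. -/
def IsSat {V : Type} {m : ℕ} (F : Fin m → Clause V) : Prop :=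
  ∃ σ : V → Bool, ∀ i, ∃ l ∈ F i, σ l.1 = l.2

/-! ### The classical random `k`-SAT model -/

/-- `Ω(n, k)`: all clauses of length `k` over `n` Boolean variables. -/
def kClauses (n k : ℕ) : Set (Clause (Fin n)) :=
  {c | HasDistinctVars c ∧ c.card = k}

/-- The law of a random `k`-SAT instance with `n` variables and `m` clauses: the clauses are
selected uniformly and independently from `Ω(n, k)`. -/
noncomputable def kSatMeasure (n k m : ℕ) : Measure (Fin m → Clause (Fin n)) :=
  Measure.pi fun _ => uniformOn (kClauses n k)

/-- A random `k`-SAT instance of density `α` (that is, with `⌊α n⌋` clauses) is UNSAT w.h.p. -/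
def KSatUnsatWhp (k : ℕ) (α : ℝ) : Prop :=
  Tendsto (fun n : ℕ => (kSatMeasure n k ⌊α * (n : ℝ)⌋₊).real {F | ¬ IsSat F}) atTop (𝓝 1)

/-- `r_k^*`: the infimum of the densities at which random `k`-SAT is UNSAT w.h.p. -/
noncomputable def rStar (k : ℕ) : ℝ := sInf {α : ℝ | KSatUnsatWhp k α}

/-! ### The community-structured model

There are `B` communities of `h` variables each; the variable `(i, a) : Fin B × Fin h` is the
`a`-th variable of the `i`-th community, and the number of variables is `n = B * h`. -/

/-- `Ω_B(n, K)` for `K = (k₁, …, k_ℓ)`: the clauses of length `k₁ + ⋯ + k_ℓ` on distinct variables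
that have, for some mutually distinct communities `i₁, …, i_ℓ`, exactly `k_j` variables from
community `i_j` for each `j`. -/
def typeClauses (B h : ℕ) (K : List ℕ) : Set (Clause (Fin B × Fin h)) :=
  {c | HasDistinctVars c ∧ c.card = K.sum ∧
    ∃ i : Fin K.length ↪ Fin B,
      ∀ j, (c.filter fun l => l.1.1 = i j).card = K.get j}

/-- The data `K₁, …, K_T`, `p₁, …, p_T` that determine the measure `P = ∑ p_t P_{K_t}`: mutually
distinct clause types, each a tuple of positive integers in non-increasing order, and their
probabilities. -/
structure ClauseMix where
  T : ℕ
  K : Fin T → List ℕ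
  p : Fin T → ℝ
  K_ne_nil : ∀ t, K t ≠ []
  K_noninc : ∀ t, (K t).Pairwise (fun x y => y ≤ x)
  K_pos : ∀ t, ∀ x ∈ K t, 1 ≤ x
  K_injective : Function.Injective K
  p_nonneg : ∀ t, 0 ≤ p t
  p_sum : ∑ t, p t = 1

/-- With `B` communities of size `h` there are clauses of each type: every entry of every `K_t` is
at most `h`, and every `K_t` has at most `B` entries. -/
def ClauseMix.Fits (D : ClauseMix) (B h : ℕ) : Prop :=
  ∀ t, (D.K t).length ≤ B ∧ ∀ x ∈ D.K t, x ≤ h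

/-- The law `P = ∑ p_t P_{K_t}` of a single clause, where `P_K` is the uniform measure on
`Ω_B(n, K)`. -/
noncomputable def ClauseMix.clauseMeasure (D : ClauseMix) (B h : ℕ) :
    Measure (Clause (Fin B × Fin h)) :=
  ∑ t, ENNReal.ofReal (D.p t) • uniformOn (typeClauses B h (D.K t))

/-- The law `P^m` of a random instance in `F(n, m, B, P)`, where `n = B * h`. -/
noncomputable def ClauseMix.instanceMeasure (D : ClauseMix) (B h m : ℕ) :
    Measure (Fin m → Clause (Fin B × Fin h)) :=
  Measure.pi fun _ => D.clauseMeasure B h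

/-- The probability that a random instance in `F(n, m, B, P)` is SAT. -/
noncomputable def ClauseMix.satProb (D : ClauseMix) (B h m : ℕ) : ℝ :=
  (D.instanceMeasure B h m).real {F | IsSat F}

/-- The probability that a random instance in `F(n, m, B, P)` is UNSAT. -/
noncomputable def ClauseMix.unsatProb (D : ClauseMix) (B h m : ℕ) : ℝ :=
  (D.instanceMeasure B h m).real {F | ¬ IsSat F}

/-- `n j = B j * h j` is the number of variables of the `j`-th model in a sequence of models with
the clause types and probabilities of `D`; it tends to infinity. -/
structure ClauseMix.IsModelSequence (D : ClauseMix) (n B h : ℕ → ℕ) : Prop where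
  size : ∀ j, n j = B j * h j
  fits : ∀ j, D.Fits (B j) (h j)
  tendsto : Tendsto n atTop atTop

/-!
The formula is unsatisfiable as soon as it contains, for some community, all `N = 2 ^ k` clauses
over the first `k` variables of that community. Conversely, fewer than `N` clauses of length `k`
inside a community are satisfiable, because each clause excludes only the fraction `1 / N` of the
assignments. So, up to powers of `h`, satisfiability is decided by whether some community receives
`N` clauses, and the expected number of such communities has order `B (m / n) ^ N`, which is `m ^ N
/ n ^ (N - 1)` up to powers of `h`. This is where the threshold `n ^ (1 - 1 / N)` comes from.

*Unsatisfiability.* The events "community `b` lacks one of its `N` distinguished clauses" are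
negatively correlated (`iidExp_mul_le`): a draw that serves one community serves no other. Hence the
probability that all of them occur is at most the product of their probabilities
(`real_pi_forall_miss_le`), which makes `exp (-c min (B, m ^ N / (n ^ (N - 1) h ^ (k N))))` an upper
bound for the probability of satisfiability (`ClauseMix.satProb_le_exp`). For bounded `h` this gives
the upper bounds in (a). When `h = O(ln n)`, the powers of `h` and of `ln n` are dominated by any
positive power of `n`; so UNSAT w.h.p. follows from `m ≥ c n ^ (1 - γ) / ln ^ θ n` with `γ < 1 / N`
(`ClauseMix.tendsto_unsatProb_of_log`). This covers (b), (c), and (d) at every positive density.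

*Satisfiability.* The events "the `N` clauses indexed by `S` share a community" are independent for
disjoint `S`. By the Lovász local lemma (`one_sub_pow_le_real_biInter_compl`), the probability that
all of them fail is at least `exp (-A m ^ N / n ^ (N - 1))` for bounded `h`
(`ClauseMix.exists_exp_le_satProb`). This bound tends to one below the threshold and is bounded away
from zero at the threshold.

*The constant `rStar`.* For (d) it has to be known that `rStar k` is positive (`rStar_pos`): at low
density the clauses have distinct representatives among the variables, by Hall's theorem and a union
bound, and the first moment method shows that the set of densities in question is nonempty.
-/

/-! ### Expectations over independent draws from a finite set -/

/-- The expectation of `φ (F 0, …, F (m - 1))` where the `F i` are independent draws from the finite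
set `Ω` with weights `w`. -/
noncomputable def iidExp {Ω : Type*} [Fintype Ω] (w : Ω → ℝ) (m : ℕ) (φ : (Fin m → Ω) → ℝ) : ℝ :=
  ∑ F, (∏ i, w (F i)) * φ F

section iidExp

variable {Ω : Type*} [Fintype Ω] {w : Ω → ℝ}

lemma iidExp_mono (hw : ∀ x, 0 ≤ w x) {m : ℕ} {φ ψ : (Fin m → Ω) → ℝ} (h : ∀ F, φ F ≤ ψ F) :
    iidExp w m φ ≤ iidExp w m ψ :=
  Finset.sum_le_sum fun F _ =>
    mul_le_mul_of_nonneg_left (h F) (Finset.prod_nonneg fun _ _ => hw _)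

lemma iidExp_nonneg (hw : ∀ x, 0 ≤ w x) {m : ℕ} {φ : (Fin m → Ω) → ℝ} (h : ∀ F, 0 ≤ φ F) :
    0 ≤ iidExp w m φ :=
  Finset.sum_nonneg fun F _ => mul_nonneg (Finset.prod_nonneg fun _ _ => hw _) (h F)

lemma iidExp_prod (m : ℕ) (u : Ω → ℝ) :
    iidExp w m (fun F => ∏ i, u (F i)) = (∑ x, w x * u x) ^ m := by
  classical
  have := Finset.prod_univ_sum (fun _ : Fin m => (Finset.univ : Finset Ω)) (fun _ x => w x * u x)
  simp only [Finset.prod_const, Finset.card_univ, Fintype.card_fin, Fintype.piFinset_univ] at this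
  simp only [iidExp, this, Finset.prod_mul_distrib]

lemma iidExp_one (hw1 : ∑ x, w x = 1) (m : ℕ) : iidExp w m (fun _ => 1) = 1 := by
  simpa [hw1] using iidExp_prod (w := w) m (fun _ => 1)

lemma iidExp_sub {m : ℕ} (φ ψ : (Fin m → Ω) → ℝ) :
    iidExp w m (fun F => φ F - ψ F) = iidExp w m φ - iidExp w m ψ := by
  simp [iidExp, mul_sub, Finset.sum_sub_distrib]

lemma iidExp_cons (m : ℕ) (φ : (Fin (m + 1) → Ω) → ℝ) :
    iidExp w (m + 1) φ = ∑ x, w x * iidExp w m (fun F => φ (Fin.cons x F)) := by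
  rw [iidExp, ← (Fin.consEquiv (fun _ : Fin (m + 1) => Ω)).sum_comp, Fintype.sum_prod_type]
  refine Finset.sum_congr rfl fun x _ => ?_
  rw [iidExp, Finset.mul_sum]
  refine Finset.sum_congr rfl fun F _ => ?_
  simp [Fin.consEquiv, Fin.prod_univ_succ, mul_assoc]

lemma iidExp_append (m s : ℕ) (φ : (Fin m → Ω) → ℝ) (ψ : (Fin s → Ω) → ℝ) :
    iidExp w (m + s) (fun F => φ (fun i => F (Fin.castAdd s i)) * ψ (fun i => F (Fin.natAdd m i))) =
      iidExp w m φ * iidExp w s ψ := by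
  rw [iidExp, ← (Fin.appendEquiv m s).sum_comp, Fintype.sum_prod_type, iidExp, iidExp,
    Finset.sum_mul_sum]
  refine Finset.sum_congr rfl fun F _ => Finset.sum_congr rfl fun G _ => ?_
  simp [Fin.appendEquiv, Fin.prod_univ_add]
  ring

/-- One draw: `A` attains its maximum everywhere outside `C` and `G` everywhere in `C`, so that
`(A - max A) * (G - max G) = 0` and the covariance is at most zero. -/
lemma sum_mul_le_mul_sum (hw : ∀ x, 0 ≤ w x) (hw1 : ∑ x, w x = 1) (C : Set Ω) (A G : Ω → ℝ)
    (hA : ∀ x ∉ C, ∀ y, A y ≤ A x) (hG : ∀ x ∈ C, ∀ y, G y ≤ G x) :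
    ∑ x, w x * (A x * G x) ≤ (∑ x, w x * A x) * ∑ x, w x * G x := by
  have hne : Nonempty Ω := by
    by_contra h
    rw [not_nonempty_iff] at h
    simp at hw1
  obtain ⟨a, ha⟩ := Finite.exists_max A
  obtain ⟨g, hg⟩ := Finite.exists_max G
  have key : ∀ x, w x * (A x * G x) =
      A a * (w x * G x) + G g * (w x * A x) - A a * G g * w x := by
    intro x
    have : (A x - A a) * (G x - G g) = 0 := by
      by_cases hx : x ∈ C
      · rw [le_antisymm (hg x) (hG x hx g)]; ring
      · rw [le_antisymm (ha x) (hA x hx a)]; ring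
    linear_combination w x * this
  have hEA : ∑ x, w x * A x ≤ A a := by
    calc ∑ x, w x * A x ≤ ∑ x, w x * A a :=
          Finset.sum_le_sum fun x _ => mul_le_mul_of_nonneg_left (ha x) (hw x)
      _ = A a := by rw [← Finset.sum_mul, hw1, one_mul]
  have hEG : ∑ x, w x * G x ≤ G g := by
    calc ∑ x, w x * G x ≤ ∑ x, w x * G g :=
          Finset.sum_le_sum fun x _ => mul_le_mul_of_nonneg_left (hg x) (hw x)
      _ = G g := by rw [← Finset.sum_mul, hw1, one_mul]
  rw [Finset.sum_congr rfl fun x _ => key x, Finset.sum_sub_distrib, Finset.sum_add_distrib,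
    ← Finset.mul_sum, ← Finset.mul_sum, ← Finset.mul_sum, hw1]
  nlinarith [mul_nonneg (sub_nonneg.2 hEA) (sub_nonneg.2 hEG)]

/-- Negative correlation: `a` can only decrease when a draw outside `C` is replaced and `g` can only
decrease when a draw in `C` is replaced. By induction on the number of draws this reduces to a
single draw. -/
lemma iidExp_mul_le (hw : ∀ x, 0 ≤ w x) (hw1 : ∑ x, w x = 1) (C : Set Ω) (m : ℕ)
    (a g : (Fin m → Ω) → ℝ)
    (ha : ∀ F i x, F i ∉ C → a (Function.update F i x) ≤ a F)
    (hg : ∀ F i x, F i ∈ C → g (Function.update F i x) ≤ g F) :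
    iidExp w m (fun F => a F * g F) ≤ iidExp w m a * iidExp w m g := by
  induction m with
  | zero => simp [iidExp]
  | succ m ih =>
    have hcons : ∀ (x y : Ω) (F : Fin m → Ω),
        (Fin.cons y F : Fin (m + 1) → Ω) = Function.update (Fin.cons x F) 0 y := fun x y F => by
      simp
    rw [iidExp_cons, iidExp_cons m a, iidExp_cons m g]
    refine le_trans (Finset.sum_le_sum fun x _ => mul_le_mul_of_nonneg_left
      (ih (fun F => a (Fin.cons x F)) (fun F => g (Fin.cons x F)) ?_ ?_) (hw x)) ?_
    · intro F i y hi
      rw [Fin.cons_update]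
      exact ha _ _ _ (by simpa using hi)
    · intro F i y hi
      rw [Fin.cons_update]
      exact hg _ _ _ (by simpa using hi)
    · refine sum_mul_le_mul_sum hw hw1 C _ _ ?_ ?_
      · intro x hx y
        refine iidExp_mono hw fun F => ?_
        rw [hcons x y F]
        exact ha _ _ _ (by simpa using hx)
      · intro x hx y
        refine iidExp_mono hw fun F => ?_
        rw [hcons x y F]
        exact hg _ _ _ (by simpa using hx)

open Classical in
/-- The indicator of the event that some element of `T` is not among the draws. -/
noncomputable def missInd {m : ℕ} (T : Finset Ω) (F : Fin m → Ω) : ℝ :=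
  if ∀ x ∈ T, ∃ i, F i = x then 0 else 1

lemma missInd_nonneg {m : ℕ} (T : Finset Ω) (F : Fin m → Ω) : 0 ≤ missInd T F := by
  unfold missInd; split_ifs <;> simp

lemma missInd_update_le {m : ℕ} (T : Finset Ω) (F : Fin m → Ω) (i : Fin m) (x : Ω) (h : F i ∉ T) :
    missInd T (Function.update F i x) ≤ missInd T F := by
  unfold missInd
  split_ifs with h1 h2 h2 <;> try simp
  refine absurd ?_ h1
  intro y hy
  obtain ⟨j, rfl⟩ := h2 y hy
  refine ⟨j, Function.update_of_ne ?_ _ _⟩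
  rintro rfl
  exact h hy

/-- For disjoint sets `T b`, missing an element of each `T b` is at most as likely as it would be if
these events were independent. -/
lemma iidExp_prod_missInd_le (hw : ∀ x, 0 ≤ w x) (hw1 : ∑ x, w x = 1) {ι : Type*} (m : ℕ)
    (T : ι → Finset Ω) (hT : Pairwise fun b c => Disjoint (T b) (T c)) (s : Finset ι) :
    iidExp w m (fun F => ∏ b ∈ s, missInd (T b) F) ≤ ∏ b ∈ s, iidExp w m (missInd (T b)) := by
  classical
  induction s using Finset.induction_on with
  | empty => simp [iidExp_one hw1]
  | insert b s hb ih =>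
    simp only [Finset.prod_insert hb]
    refine (iidExp_mul_le hw hw1 (T b : Set Ω) m _ _ (fun F i x hi => ?_)
      (fun F i x hi => ?_)).trans
      (mul_le_mul_of_nonneg_left ih (iidExp_nonneg hw (missInd_nonneg _)))
    · exact missInd_update_le _ _ _ _ (by simpa using hi)
    · refine Finset.prod_le_prod (fun _ _ => missInd_nonneg _ _) fun c hc => ?_
      refine missInd_update_le _ _ _ _ ?_
      refine Finset.disjoint_left.1 (hT (i := b) (j := c) ?_) (by simpa using hi)
      rintro rfl
      exact hb hc

/-- All elements of `T` are among the draws with probability at least `(1 - (1 - q) ^ s) ^ |T|`: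
each element can be sought in a block of `s` draws of its own. -/
lemma le_one_sub_iidExp_missInd (hw : ∀ x, 0 ≤ w x) (hw1 : ∑ x, w x = 1) (q : ℝ) (hq0 : 0 ≤ q)
    (hq1 : q ≤ 1) (s : ℕ) (T : Finset Ω) (hT : ∀ x ∈ T, q ≤ w x) (m : ℕ) (hm : T.card * s ≤ m) :
    (1 - (1 - q) ^ s) ^ T.card ≤ 1 - iidExp w m (missInd T) := by
  classical
  induction T using Finset.induction_on generalizing m with
  | empty => simp [missInd, iidExp]
  | insert x T hx ih =>
    rw [Finset.card_insert_of_notMem hx] at hm ⊢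
    obtain ⟨m, rfl⟩ : ∃ m', m = m' + s := ⟨m - s, by
      have : s ≤ m := le_trans (by nlinarith) hm
      omega⟩
    have hm' : T.card * s ≤ m := by nlinarith
    have h1 : 1 - iidExp w s (missInd {x}) ≥ 1 - (1 - q) ^ s := by
      have : missInd {x} = fun F : Fin s → Ω => ∏ i, if F i = x then (0 : ℝ) else 1 := by
        funext F
        by_cases h : ∃ i, F i = x
        · obtain ⟨i, hi⟩ := h
          rw [Finset.prod_eq_zero (Finset.mem_univ i) (by simp [hi])]
          simp only [missInd, Finset.mem_singleton, forall_eq, if_pos (⟨i, hi⟩ : ∃ i, F i = x)]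
        · simp only [missInd, Finset.mem_singleton, forall_eq, if_neg h]
          push Not at h
          simp [h]
      rw [this, iidExp_prod s fun y => if y = x then (0 : ℝ) else 1]
      have h2 : ∑ y, w y * (if y = x then (0 : ℝ) else 1) = 1 - w x := by
        have e : ∀ y, w y * (if y = x then (0 : ℝ) else 1) = w y - if y = x then w y else 0 := by
          intro y
          split_ifs <;> simp
        simp [e, Finset.sum_sub_distrib, hw1]
      rw [h2]
      have h3 : w x ≤ 1 := hw1 ▸ Finset.single_le_sum (fun y _ => hw y) (Finset.mem_univ x)
      have := pow_le_pow_left₀ (sub_nonneg.2 h3)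
        (sub_le_sub_left (hT x (Finset.mem_insert_self _ _)) 1) s
      linarith
    have h0 : 0 ≤ 1 - (1 - q) ^ s :=
      sub_nonneg.2 (pow_le_one₀ (by linarith) (by linarith))
    have h2 := ih (fun y hy => hT y (Finset.mem_insert_of_mem hy)) m hm'
    have h3 : (1 - iidExp w m (missInd T)) * (1 - iidExp w s (missInd {x})) ≤
        1 - iidExp w (m + s) (missInd (insert x T)) := by
      have hsub : ∀ (r : ℕ) (S : Finset Ω),
          1 - iidExp w r (missInd S) = iidExp w r (fun G => 1 - missInd S G) := fun r S => by
        rw [iidExp_sub, iidExp_one hw1]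
      rw [hsub, hsub, hsub, ← iidExp_append]
      refine iidExp_mono hw fun F => ?_
      by_cases h : ∀ y ∈ insert x T, ∃ i, F i = y
      · have hz : missInd (insert x T) F = 0 := if_pos h
        rw [hz, sub_zero]
        have e1 : ∀ (r : ℕ) (S : Finset Ω) (G : Fin r → Ω),
            0 ≤ 1 - missInd S G ∧ 1 - missInd S G ≤ 1 := by
          intro r S G
          unfold missInd; split_ifs <;> simp
        exact mul_le_one₀ (e1 _ _ _).2 (e1 _ _ _).1 (e1 _ _ _).2
      · have hz : missInd (insert x T) F = 1 := if_neg h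
        rw [hz, sub_self]
        by_contra hc
        push Not at hc
        have hA : ∀ y ∈ T, ∃ i, F (Fin.castAdd s i) = y := by
          by_contra hA
          have : missInd T (fun i => F (Fin.castAdd s i)) = 1 := if_neg hA
          rw [this] at hc
          simp at hc
        have hB : ∀ y ∈ ({x} : Finset Ω), ∃ i, F (Fin.natAdd m i) = y := by
          by_contra hB
          have : missInd {x} (fun i => F (Fin.natAdd m i)) = 1 := if_neg hB
          rw [this] at hc
          simp at hc
        refine h fun y hy => ?_
        rcases Finset.mem_insert.1 hy with rfl | hy
        · obtain ⟨i, hi⟩ := hB y (Finset.mem_singleton_self _)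
          exact ⟨_, hi⟩
        · obtain ⟨i, hi⟩ := hA y hy
          exact ⟨_, hi⟩
    refine le_trans ?_ h3
    rw [pow_succ]
    exact mul_le_mul h2 h1 h0 (le_trans (pow_nonneg h0 _) h2)

/-- The probability of an event under a power of a probability measure on a finite set. -/
lemma real_pi_eq_iidExp [MeasurableSpace Ω] [MeasurableSingletonClass Ω] (μ : Measure Ω)
    [IsProbabilityMeasure μ] (m : ℕ) (A : Set (Fin m → Ω)) :
    (Measure.pi fun _ : Fin m => μ).real A =
      iidExp (fun x => μ.real {x}) m (A.indicator fun _ => 1) := by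
  classical
  have := sum_measureReal_singleton (μ := Measure.pi fun _ : Fin m => μ)
    (Finset.univ.filter (· ∈ A))
  rw [Finset.coe_filter] at this
  simp only [Finset.mem_univ, true_and, Set.ofPred_mem_eq] at this
  rw [← this, iidExp, Finset.sum_filter]
  refine Finset.sum_congr rfl fun F _ => ?_
  by_cases h : F ∈ A
  · simp [h, measureReal_def, Measure.pi_singleton, ENNReal.toReal_prod]
  · simp [h]

end iidExp

/-- If the sets `T b`, `b ∈ ι`, of `N` elements each are disjoint and all their elements have
probability at least `q`, then among `m ≥ N s` draws some `T b` is contained with probability at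
least `1 - exp (-|ι| (min 1 (q s) / 2) ^ N)`. -/
lemma real_pi_forall_miss_le {Ω ι : Type*} [Fintype Ω] [Fintype ι] [MeasurableSpace Ω]
    [MeasurableSingletonClass Ω] (μ : Measure Ω) [IsProbabilityMeasure μ] (T : ι → Finset Ω)
    (hT : Pairwise fun b c => Disjoint (T b) (T c)) (N : ℕ) (hN : ∀ b, (T b).card = N) (q : ℝ)
    (hq0 : 0 ≤ q) (hq1 : q ≤ 1) (hq : ∀ b, ∀ x ∈ T b, q ≤ μ.real {x}) (m s : ℕ) (hm : N * s ≤ m) :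
    (Measure.pi fun _ : Fin m => μ).real {F | ∀ b, ¬ ∀ x ∈ T b, ∃ i, F i = x} ≤
      Real.exp (-(Fintype.card ι * (min 1 (q * s) / 2) ^ N)) := by
  classical
  have hw : ∀ x, 0 ≤ μ.real {x} := fun x => measureReal_nonneg
  have hw1 : ∑ x, μ.real {x} = 1 := by
    rw [sum_measureReal_singleton]; simp
  have hb : ∀ b, iidExp (fun x => μ.real {x}) m (missInd (T b)) ≤
      Real.exp (-(min 1 (q * s) / 2) ^ N) := by
    intro b
    have h1 := le_one_sub_iidExp_missInd hw hw1 q hq0 hq1 s (T b) (hq b) m (by rwa [hN])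
    rw [hN] at h1
    have h2 : min 1 (q * s) / 2 ≤ 1 - (1 - q) ^ s := by
      have h3 : (1 - q) ^ s ≤ Real.exp (-(min 1 (q * s))) := by
        calc (1 - q) ^ s ≤ Real.exp (-q) ^ s :=
              pow_le_pow_left₀ (by linarith) (Real.one_sub_le_exp_neg q) s
          _ = Real.exp (-(q * s)) := by rw [← Real.exp_nat_mul]; ring_nf
          _ ≤ _ := Real.exp_le_exp.2 (neg_le_neg (min_le_right _ _))
      set y := min 1 (q * s)
      have hy0 : 0 ≤ y := le_min zero_le_one (by positivity)
      have hy1 : y ≤ 1 := min_le_left _ _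
      have h4 : Real.exp (-y) ≤ 1 - y / 2 := by
        have h5 := Real.add_one_le_exp y
        rw [Real.exp_neg, inv_le_comm₀ (Real.exp_pos _) (by linarith)]
        refine le_trans ?_ h5
        rw [inv_le_iff_one_le_mul₀ (by linarith)]
        nlinarith
      linarith
    have h3 : (min 1 (q * s) / 2) ^ N ≤ (1 - (1 - q) ^ s) ^ N := pow_le_pow_left₀
      (div_nonneg (le_min zero_le_one (by positivity)) zero_le_two) h2 N
    have := Real.one_sub_le_exp_neg ((min 1 (q * s) / 2) ^ N)
    linarith
  rw [real_pi_eq_iidExp]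
  calc _ ≤ iidExp (fun x => μ.real {x}) m (fun F => ∏ b, missInd (T b) F) := by
        refine iidExp_mono hw fun F => ?_
        by_cases h : ∀ b, ¬ ∀ x ∈ T b, ∃ i, F i = x
        · have : ∀ b, missInd (T b) F = 1 := fun b => if_neg (h b)
          simp only [this, Finset.prod_const_one]
          exact Set.indicator_le_self' (fun _ _ => zero_le_one) _
        · rw [Set.indicator_of_notMem (by simpa using h)]
          exact Finset.prod_nonneg fun _ _ => missInd_nonneg _ _
    _ ≤ ∏ b, iidExp (fun x => μ.real {x}) m (missInd (T b)) :=
        iidExp_prod_missInd_le hw hw1 m T hT _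
    _ ≤ ∏ _b : ι, Real.exp (-(min 1 (q * s) / 2) ^ N) :=
        Finset.prod_le_prod (fun b _ => iidExp_nonneg hw (missInd_nonneg _)) fun b _ => hb b
    _ = _ := by
        rw [Finset.prod_const, ← Real.exp_nat_mul, Finset.card_univ]; ring_nf

/-! ### The local lemma and the sizes of the fibres of a random function -/

/-- The symmetric Lovász local lemma. The events `A j` with `¬ r i j` are those on which `A i` does
not depend. -/
lemma one_sub_pow_le_real_biInter_compl {X ι : Type*} [MeasurableSpace X] (ν : Measure X)
    [IsProbabilityMeasure ν] (A : ι → Set X) (r : ι → ι → Prop) (U : Finset ι) (p : ℝ)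
    (hp0 : 0 ≤ p) (hp1 : 2 * p ≤ 1)
    (hind : ∀ i ∈ U, ∀ s ⊆ U, (∀ j ∈ s, ¬ r i j) →
      ν.real (A i ∩ ⋂ j ∈ s, (A j)ᶜ) ≤ p * ν.real (⋂ j ∈ s, (A j)ᶜ))
    (hdeg : ∀ i ∈ U, ∀ s ⊆ U, (∀ j ∈ s, r i j) → 4 * p * s.card ≤ 1) :
    (1 - 2 * p) ^ U.card ≤ ν.real (⋂ j ∈ U, (A j)ᶜ) := by
  classical
  -- Conditionally on `⋂ j ∈ s, (A j)ᶜ`, the event `A i` has probability at most `2 p`.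
  have main : ∀ n : ℕ, ∀ s ⊆ U, s.card = n → ∀ i ∈ U,
      ν.real (A i ∩ ⋂ j ∈ s, (A j)ᶜ) ≤ 2 * p * ν.real (⋂ j ∈ s, (A j)ᶜ) := by
    intro n
    induction n using Nat.strong_induction_on with
    | _ n ih =>
      intro s hs hn i hi
      set s₁ := s.filter (r i) with hs₁
      set s₂ := s.filter (fun j => ¬ r i j) with hs₂
      have h₁ : s₁ ⊆ U := (Finset.filter_subset _ _).trans hs
      have h₂ : s₂ ⊆ U := (Finset.filter_subset _ _).trans hs
      have hV : (⋂ j ∈ s, (A j)ᶜ) ⊆ ⋂ j ∈ s₂, (A j)ᶜ :=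
        Set.biInter_subset_biInter_left (Finset.filter_subset _ _)
      have e1 := hind i hi s₂ h₂ (fun j hj => (Finset.mem_filter.1 hj).2)
      have e2 : ν.real (A i ∩ ⋂ j ∈ s, (A j)ᶜ) ≤ ν.real (A i ∩ ⋂ j ∈ s₂, (A j)ᶜ) :=
        measureReal_mono (Set.inter_subset_inter_right _ hV)
      -- The neighbours `s₁` of `i` remove at most half of the mass of `⋂ j ∈ s₂, (A j)ᶜ`.
      have e3 : ν.real (⋂ j ∈ s₂, (A j)ᶜ) ≤ 2 * ν.real (⋂ j ∈ s, (A j)ᶜ) := by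
        have hcover : (⋂ j ∈ s₂, (A j)ᶜ) ⊆
            (⋂ j ∈ s, (A j)ᶜ) ∪ ⋃ j ∈ s₁, (A j ∩ ⋂ j ∈ s₂, (A j)ᶜ) := by
          intro x hx
          by_cases h : ∃ j ∈ s₁, x ∈ A j
          · obtain ⟨j, hj, hxj⟩ := h
            exact Or.inr (Set.mem_biUnion hj ⟨hxj, hx⟩)
          · push Not at h
            refine Or.inl (Set.mem_iInter₂.2 fun j hj => ?_)
            by_cases hr : r i j
            · exact h j (Finset.mem_filter.2 ⟨hj, hr⟩)
            · exact Set.mem_iInter₂.1 hx j (Finset.mem_filter.2 ⟨hj, hr⟩)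
        have e4 : ν.real (⋂ j ∈ s₂, (A j)ᶜ) ≤ ν.real (⋂ j ∈ s, (A j)ᶜ) +
            ∑ j ∈ s₁, ν.real (A j ∩ ⋂ j ∈ s₂, (A j)ᶜ) :=
          (measureReal_mono hcover).trans ((measureReal_union_le _ _).trans
            (by gcongr; exact measureReal_biUnion_finset_le _ _))
        rcases s₁.eq_empty_or_nonempty with h0 | h0
        · rw [h0, Finset.sum_empty] at e4
          have : 0 ≤ ν.real (⋂ j ∈ s, (A j)ᶜ) := measureReal_nonneg
          linarith
        · have hlt : s₂.card < n := by
            have : s₁.card + s₂.card = s.card := Finset.card_filter_add_card_filter_not (r i)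
            have := h0.card_pos
            omega
          have e5 : ∑ j ∈ s₁, ν.real (A j ∩ ⋂ j ∈ s₂, (A j)ᶜ) ≤
              s₁.card * (2 * p * ν.real (⋂ j ∈ s₂, (A j)ᶜ)) := by
            rw [← nsmul_eq_mul]
            exact Finset.sum_le_card_nsmul _ _ _ fun j hj => ih _ hlt s₂ h₂ rfl j (h₁ hj)
          have e6 := hdeg i hi s₁ h₁ (fun j hj => (Finset.mem_filter.1 hj).2)
          have e7 : 0 ≤ ν.real (⋂ j ∈ s₂, (A j)ᶜ) := measureReal_nonneg
          nlinarith
      nlinarith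
  have step : ∀ s ⊆ U, (1 - 2 * p) ^ s.card ≤ ν.real (⋂ j ∈ s, (A j)ᶜ) := by
    intro s
    induction s using Finset.induction_on with
    | empty => simp
    | insert i s hi ih =>
      intro hs
      have hs' : s ⊆ U := (Finset.subset_insert _ _).trans hs
      have h1 := ih hs'
      have h2 := main _ s hs' rfl i (hs (Finset.mem_insert_self _ _))
      have h3 : (⋂ j ∈ s, (A j)ᶜ) ⊆
          (⋂ j ∈ insert i s, (A j)ᶜ) ∪ (A i ∩ ⋂ j ∈ s, (A j)ᶜ) := by
        intro x hx
        by_cases h : x ∈ A i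
        · exact Or.inr ⟨h, hx⟩
        · rw [Finset.set_biInter_insert]
          exact Or.inl ⟨h, hx⟩
      have h4 := (measureReal_mono h3 (μ := ν)).trans (measureReal_union_le _ _)
      rw [Finset.card_insert_of_notMem hi, pow_succ]
      nlinarith
  exact step U subset_rfl

/-- Events that depend on disjoint sets of coordinates of a product are independent. -/
lemma real_pi_inter_of_dependsOn {Ω ι : Type*} [Finite Ω] [Fintype ι] [MeasurableSpace Ω]
    [MeasurableSingletonClass Ω] (μ : Measure Ω) [IsProbabilityMeasure μ]
    (S S' : Finset ι) (hSS' : Disjoint S S') (A X : Set (ι → Ω))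
    (hA : DependsOn (fun F => F ∈ A) (S : Set ι)) (hX : DependsOn (fun F => F ∈ X) (S' : Set ι)) :
    (Measure.pi fun _ : ι => μ).real (A ∩ X) =
      (Measure.pi fun _ : ι => μ).real A * (Measure.pi fun _ : ι => μ).real X := by
  have hi := (iIndepFun_pi (μ := fun _ : ι => μ) (X := fun _ (x : Ω) => x)
    (fun _ => aemeasurable_id)).indepFun_finset S S' hSS' (fun i => measurable_pi_apply i)
  have key : ∀ (R : Finset ι) (Y : Set (ι → Ω)), DependsOn (fun F => F ∈ Y) (R : Set ι) →
      Y = (fun (F : ι → Ω) (i : R) => F i) ⁻¹' ((fun (F : ι → Ω) (i : R) => F i) '' Y) := by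
    intro R Y hY
    refine Set.Subset.antisymm (Set.subset_preimage_image _ _) ?_
    rintro F ⟨G, hG, hFG⟩
    have := hY (x := G) (y := F) fun i hi => congrFun hFG ⟨i, hi⟩
    exact this.mp hG
  have := hi.measure_inter_preimage_eq_mul ((fun (F : ι → Ω) (i : S) => F i) '' A)
    ((fun (F : ι → Ω) (i : S') => F i) '' X) (Set.toFinite _).measurableSet
    (Set.toFinite _).measurableSet
  rw [← key S A hA, ← key S' X hX] at this
  simp only [measureReal_def, this, ENNReal.toReal_mul]

lemma real_pi_forall_mem_finset {Ω ι : Type*} [Fintype ι] [MeasurableSpace Ω] (μ : Measure Ω)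
    [IsProbabilityMeasure μ] (S : Finset ι) (Q : Set Ω) :
    (Measure.pi fun _ : ι => μ).real {F | ∀ i ∈ S, F i ∈ Q} = μ.real Q ^ S.card := by
  classical
  have : {F : ι → Ω | ∀ i ∈ S, F i ∈ Q} = Set.univ.pi fun i => if i ∈ S then Q else Set.univ := by
    ext F
    simp only [Set.mem_ofPred_eq, Set.mem_pi, Set.mem_univ, forall_const]
    refine forall_congr' fun i => ?_
    split_ifs with h <;> simp [h]
  rw [this, measureReal_def, Measure.pi_pi, ENNReal.toReal_prod]
  simp only [apply_ite μ, apply_ite ENNReal.toReal, measure_univ, ENNReal.toReal_one]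
  rw [Finset.prod_ite_mem, Finset.univ_inter, Finset.prod_const, measureReal_def]

/-- If each of the classes `Q b` has probability at most `ρ`, then it is not too unlikely that among
`m` draws every class occurs less than `N` times. The local lemma is applied to the events that the
draws indexed by an `N`-element set share a class. -/
lemma one_sub_pow_le_real_pi_card_lt {Ω ι : Type*} [Finite Ω] [Fintype ι] [MeasurableSpace Ω]
    [MeasurableSingletonClass Ω] (μ : Measure Ω) [IsProbabilityMeasure μ] (Q : ι → Set Ω) (ρ : ℝ)
    (hρ : ∀ b, μ.real (Q b) ≤ ρ) (N m : ℕ) (p : ℝ) (hp : Fintype.card ι * ρ ^ N ≤ p)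
    (hp0 : 0 ≤ p) (hp1 : 2 * p ≤ 1) (hp2 : 4 * p * (N * (m : ℝ) ^ (N - 1)) ≤ 1) :
    (1 - 2 * p) ^ (m ^ N) ≤ (Measure.pi fun _ : Fin m => μ).real
      {F | ∀ b, ∀ S : Finset (Fin m), S.card = N → ∃ i ∈ S, F i ∉ Q b} := by
  classical
  set ν := Measure.pi fun _ : Fin m => μ
  set A : Finset (Fin m) → Set (Fin m → Ω) := fun S => {F | ∃ b, ∀ i ∈ S, F i ∈ Q b}
  set U := (Finset.univ : Finset (Fin m)).powersetCard N with hU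
  have hmem : ∀ S, S ∈ U ↔ S.card = N := fun S => by simp [hU]
  have hdepA : ∀ S, DependsOn (fun F => F ∈ A S) (S : Set (Fin m)) := by
    intro S F G h
    refine propext (exists_congr fun b => forall₂_congr fun i hi => ?_)
    rw [h i hi]
  have hA : ∀ S ∈ U, ν.real (A S) ≤ p := by
    intro S hS
    have : A S = ⋃ b ∈ (Finset.univ : Finset ι), {F | ∀ i ∈ S, F i ∈ Q b} := by
      ext F; simp [A]
    rw [this]
    refine (measureReal_biUnion_finset_le _ _).trans (le_trans ?_ hp)
    rw [← nsmul_eq_mul, ← Finset.card_univ]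
    refine Finset.sum_le_card_nsmul _ _ _ fun b _ => ?_
    rw [real_pi_forall_mem_finset, (hmem S).1 hS]
    exact pow_le_pow_left₀ measureReal_nonneg (hρ b) N
  have h := one_sub_pow_le_real_biInter_compl ν A (fun S S' => ¬ Disjoint S S') U p hp0 hp1 ?_ ?_
  · have hcard : U.card ≤ m ^ N := by
      rw [hU, Finset.card_powersetCard, Finset.card_univ, Fintype.card_fin]
      exact Nat.choose_le_pow m N
    refine (pow_le_pow_of_le_one (by linarith) (by linarith) hcard).trans
      (h.trans (measureReal_mono ?_))
    intro F hF b S hS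
    have := Set.mem_iInter₂.1 hF S ((hmem S).2 hS)
    by_contra hc
    push Not at hc
    exact this ⟨b, hc⟩
  · intro S hS s hs hsd
    push Not at hsd
    refine le_of_eq_of_le (real_pi_inter_of_dependsOn μ S Sᶜ disjoint_compl_right _ _ (hdepA S) ?_)
      (mul_le_mul_of_nonneg_right (hA S hS) measureReal_nonneg)
    intro F G hFG
    simp only [Set.mem_iInter, Set.mem_compl_iff]
    refine propext (forall₂_congr fun j hj => not_congr (Eq.to_iff (hdepA j fun i hi => ?_)))
    refine hFG i ?_
    simpa using Finset.disjoint_right.1 (hsd j hj) hi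
  · intro S hS s hs hsr
    -- A set that meets `S` is determined by a common element and its `N - 1` other elements.
    have hsub : s ⊆ S.biUnion fun i =>
        ((Finset.univ : Finset (Fin m)).powersetCard (N - 1)).image (insert i) := by
      intro T hT
      obtain ⟨i, hiS, hiT⟩ := Finset.not_disjoint_iff.1 (hsr T hT)
      refine Finset.mem_biUnion.2 ⟨i, hiS, Finset.mem_image.2 ⟨T.erase i, ?_, ?_⟩⟩
      · rw [Finset.mem_powersetCard_univ, Finset.card_erase_of_mem hiT, (hmem T).1 (hs hT)]
      · exact Finset.insert_erase hiT
    have hc : s.card ≤ N * m ^ (N - 1) := by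
      refine (Finset.card_le_card hsub).trans ?_
      rw [← (hmem S).1 hS]
      refine Finset.card_biUnion_le_card_mul _ _ _ fun i _ => Finset.card_image_le.trans ?_
      rw [Finset.card_powersetCard, Finset.card_univ, Fintype.card_fin]
      exact Nat.choose_le_pow m _
    have hc' : (s.card : ℝ) ≤ N * (m : ℝ) ^ (N - 1) := by exact_mod_cast hc
    nlinarith

/-! ### Clauses and communities -/

lemma uniformOn_real_coe {Ω : Type*} [DecidableEq Ω] [MeasurableSpace Ω]
    [MeasurableSingletonClass Ω] (s t : Finset Ω) :
    (uniformOn (s : Set Ω)).real (t : Set Ω) = ((s ∩ t).card : ℝ) / s.card := by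
  rw [measureReal_def, uniformOn_apply_finset, ENNReal.toReal_div]
  simp

lemma uniformOn_real {Ω : Type*} [Fintype Ω] [MeasurableSpace Ω]
    [MeasurableSingletonClass Ω] (s t : Set Ω) :
    (uniformOn s).real t = ((s ∩ t).ncard : ℝ) / s.ncard := by
  classical
  have := uniformOn_real_coe s.toFinset t.toFinset
  simpa [Set.ncard_eq_toFinset_card', Set.toFinset_inter] using this

/-- The assignments that falsify a clause form a fraction of at most `2 ^ (-k)` of all, where `k` is
the length of the clause. -/
lemma card_falsify_mul_le {V : Type} [Fintype V] [DecidableEq V] (c : Clause V)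
    (hc : HasDistinctVars c) :
    (Finset.univ.filter fun σ : V → Bool => ∀ l ∈ c, σ l.1 ≠ l.2).card * 2 ^ c.card ≤
      2 ^ Fintype.card V := by
  classical
  -- A falsifying assignment is forced on the variables of the clause and free elsewhere.
  set t : V → Finset Bool := fun v =>
    Finset.univ.filter fun b => ∀ l ∈ c, l.1 = v → b ≠ l.2
  have hsub : (Finset.univ.filter fun σ : V → Bool => ∀ l ∈ c, σ l.1 ≠ l.2) ⊆
      Fintype.piFinset t := by
    intro σ hσ
    simp only [Finset.mem_filter, Finset.mem_univ, true_and] at hσ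
    refine Fintype.mem_piFinset.2 fun v => ?_
    simp only [t, Finset.mem_filter, Finset.mem_univ, true_and]
    rintro l hl rfl
    exact hσ l hl
  have ht : ∀ v, (t v).card ≤ if v ∈ c.image Prod.fst then 1 else 2 := by
    intro v
    split_ifs with h
    · obtain ⟨l, hl, rfl⟩ := Finset.mem_image.1 h
      refine Finset.card_le_one.2 fun a ha b hb => ?_
      simp only [t, Finset.mem_filter, Finset.mem_univ, true_and] at ha hb
      have h1 := ha l hl rfl
      have h2 := hb l hl rfl
      rw [← Bool.eq_not] at h1 h2
      rw [h1, h2]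
    · exact (Finset.card_le_univ _).trans (by simp)
  have hcard : (c.image Prod.fst).card = c.card := Finset.card_image_of_injOn hc
  calc _ ≤ (∏ v, if v ∈ c.image Prod.fst then 1 else 2) * 2 ^ c.card := by
        refine Nat.mul_le_mul_right _ ((Finset.card_le_card hsub).trans ?_)
        rw [Fintype.card_piFinset]
        exact Finset.prod_le_prod' fun v _ => ht v
    _ = 2 ^ Fintype.card V := by
        rw [Finset.prod_ite, Finset.prod_const_one, one_mul, Finset.prod_const,
          Finset.filter_not, Finset.filter_mem_eq_inter, Finset.univ_inter,
          ← Finset.compl_eq_univ_sdiff, Finset.card_compl, hcard, ← pow_add,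
          Nat.sub_add_cancel (hcard ▸ Finset.card_le_univ _)]

/-- Fewer than `2 ^ k` clauses of length `k` can be satisfied simultaneously. -/
lemma exists_assignment_of_card_lt {V ι : Type} [Fintype V] [DecidableEq V] (k : ℕ)
    (I : Finset ι) (hI : I.card < 2 ^ k) (F : ι → Clause V)
    (hF : ∀ i ∈ I, HasDistinctVars (F i) ∧ (F i).card = k) :
    ∃ σ : V → Bool, ∀ i ∈ I, ∃ l ∈ F i, σ l.1 = l.2 := by
  classical
  by_contra hcon
  push Not at hcon
  have hsub : (Finset.univ : Finset (V → Bool)) ⊆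
      I.biUnion fun i => Finset.univ.filter fun σ : V → Bool => ∀ l ∈ F i, σ l.1 ≠ l.2 := by
    intro σ _
    obtain ⟨i, hi, h⟩ := hcon σ
    exact Finset.mem_biUnion.2 ⟨i, hi, by simpa using h⟩
  have h1 := (Finset.card_le_card hsub).trans Finset.card_biUnion_le
  have h2 : (∑ i ∈ I, (Finset.univ.filter fun σ : V → Bool => ∀ l ∈ F i, σ l.1 ≠ l.2).card) * 2 ^ k
      ≤ I.card * 2 ^ Fintype.card V := by
    rw [Finset.sum_mul, ← smul_eq_mul]
    refine Finset.sum_le_card_nsmul _ _ _ fun i hi => ?_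
    rw [← (hF i hi).2]
    exact card_falsify_mul_le _ (hF i hi).1
  have h3 : Fintype.card (V → Bool) = 2 ^ Fintype.card V := by simp
  rw [Finset.card_univ, h3] at h1
  have h4 : 0 < 2 ^ Fintype.card V := by positivity
  have h5 := (Nat.mul_le_mul_right (2 ^ k) h1).trans h2
  rw [mul_comm] at h5
  exact absurd (Nat.le_of_mul_le_mul_right h5 h4) (by omega)

lemma mem_typeClauses_singleton {B h k : ℕ} {c : Clause (Fin B × Fin h)} :
    c ∈ typeClauses B h [k] ↔
      HasDistinctVars c ∧ c.card = k ∧ ∃ b, ∀ l ∈ c, l.1.1 = b := by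
  constructor
  · rintro ⟨h1, h2, i, h3⟩
    have h2' : c.card = k := by simpa using h2
    refine ⟨h1, h2', i ⟨0, by simp⟩, ?_⟩
    have := h3 ⟨0, by simp⟩
    rw [← Finset.card_filter_eq_iff, this, h2']
    rfl
  · rintro ⟨h1, h2, b, h3⟩
    refine ⟨h1, by simpa using h2, ⟨fun _ => b, fun x y _ => ?_⟩, fun j => ?_⟩
    · have := x.2; have := y.2; ext; simp at *
    · have : c.filter (fun l => l.1.1 = b) = c := Finset.filter_true_of_mem h3
      simp [this, h2]

lemma typeClauses_nonempty {B h : ℕ} {K : List ℕ} (hB : K.length ≤ B) (hh : ∀ x ∈ K, x ≤ h) :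
    (typeClauses B h K).Nonempty := by
  classical
  have hle : ∀ j, K.get j ≤ h := fun j => hh _ (List.get_mem _ _)
  let e : (Σ j : Fin K.length, Fin (K.get j)) ↪ Literal (Fin B × Fin h) :=
    ⟨fun x => ((Fin.castLE hB x.1, Fin.castLE (hle x.1) x.2), true), by
      rintro ⟨j, a⟩ ⟨j', a'⟩ hxy
      simp only [Prod.mk.injEq, and_true, Fin.castLE_inj] at hxy
      obtain ⟨rfl, h2⟩ := hxy
      simpa using h2⟩
  refine ⟨Finset.univ.map e, ?_, ?_, Fin.castLEEmb hB, fun j => ?_⟩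
  · intro l hl l' hl' hll'
    simp only [Finset.coe_map, Finset.coe_univ, Set.image_univ, Set.mem_range] at hl hl'
    obtain ⟨x, rfl⟩ := hl
    obtain ⟨x', rfl⟩ := hl'
    exact Prod.ext hll' rfl
  · simp [Fintype.card_sigma, ← List.sum_ofFn]
  · rw [Finset.filter_map, Finset.card_map]
    have : (Finset.univ.filter
          ((fun l : Literal (Fin B × Fin h) => l.1.1 = Fin.castLEEmb hB j) ∘ e)) =
        (Finset.univ : Finset (Fin (K.get j))).map ⟨Sigma.mk j, sigma_mk_injective⟩ := by
      ext ⟨j', a⟩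
      simp only [Finset.mem_filter, Finset.mem_univ, true_and, Function.comp_apply, Finset.mem_map,
        Function.Embedding.coeFn_mk]
      constructor
      · intro hj
        obtain rfl : j' = j := Fin.castLE_injective hB hj
        exact ⟨a, rfl⟩
      · rintro ⟨a', ha'⟩
        exact congrArg (Fin.castLE hB) (congrArg Sigma.fst ha').symm
    rw [this, Finset.card_map, Finset.card_univ, Fintype.card_fin]

/-- The clause over the first `k` variables of the community `b` with signs `s`. -/
def signClause {B h k : ℕ} (hk : k ≤ h) (b : Fin B) (s : Fin k → Bool) :
    Clause (Fin B × Fin h) :=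
  Finset.univ.map ⟨fun a => ((b, Fin.castLE hk a), s a), fun a a' haa' => by
    simpa using congrArg (fun l : Literal (Fin B × Fin h) => l.1.2) haa'⟩

lemma mem_signClause {B h k : ℕ} {hk : k ≤ h} {b : Fin B} {s : Fin k → Bool}
    {l : Literal (Fin B × Fin h)} :
    l ∈ signClause hk b s ↔ ∃ a, ((b, Fin.castLE hk a), s a) = l := by
  simp only [signClause, Finset.mem_map, Finset.mem_univ, true_and]
  rfl

lemma signClause_mem_typeClauses {B h k : ℕ} (hk : k ≤ h) (b : Fin B) (s : Fin k → Bool) :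
    signClause hk b s ∈ typeClauses B h [k] := by
  refine mem_typeClauses_singleton.2 ⟨?_, by simp [signClause], b, ?_⟩
  · intro l hl l' hl' hll'
    obtain ⟨a, rfl⟩ := mem_signClause.1 hl
    obtain ⟨a', rfl⟩ := mem_signClause.1 hl'
    simp only [Prod.mk.injEq, Fin.castLE_inj, true_and] at hll'
    rw [hll']
  · intro l hl
    obtain ⟨a, rfl⟩ := mem_signClause.1 hl
    rfl

lemma signClause_inj {B h k : ℕ} (hk0 : 1 ≤ k) (hk : k ≤ h) {b b' : Fin B} {s s' : Fin k → Bool}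
    (he : signClause hk b s = signClause hk b' s') : b = b' ∧ s = s' := by
  have h1 : ∀ a, b' = b ∧ s' a = s a := by
    intro a
    have : ((b, Fin.castLE hk a), s a) ∈ signClause hk b' s' := he ▸ mem_signClause.2 ⟨a, rfl⟩
    obtain ⟨a', ha'⟩ := mem_signClause.1 this
    simp only [Prod.mk.injEq, Fin.castLE_inj] at ha'
    obtain ⟨⟨h1, rfl⟩, h2⟩ := ha'
    exact ⟨h1, h2⟩
  exact ⟨(h1 ⟨0, hk0⟩).1.symm, funext fun a => (h1 a).2.symm⟩

/-- A formula that contains all `2 ^ k` clauses over the first `k` variables of some community is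
unsatisfiable. -/
lemma not_isSat_of_signClause {B h k m : ℕ} (hk : k ≤ h) (b : Fin B)
    (F : Fin m → Clause (Fin B × Fin h)) (hF : ∀ s, ∃ i, F i = signClause hk b s) :
    ¬ IsSat F := by
  rintro ⟨σ, hσ⟩
  -- The clause whose literals are all falsified by `σ`.
  obtain ⟨i, hi⟩ := hF fun a => !σ (b, Fin.castLE hk a)
  obtain ⟨l, hl, h⟩ := hσ i
  rw [hi] at hl
  obtain ⟨a, rfl⟩ := mem_signClause.1 hl
  simp at h

/-- A crude count: choose a community and `k` of its `2 h` literals. -/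
lemma card_typeClauses_le (B h k : ℕ) : (typeClauses B h [k]).ncard ≤ B * (2 * h) ^ k := by
  classical
  have hsub : typeClauses B h [k] ⊆ ((Finset.univ : Finset (Fin B)).biUnion fun b =>
      (({b} ×ˢ Finset.univ) ×ˢ Finset.univ : Finset (Literal (Fin B × Fin h))).powersetCard k :
        Finset (Clause (Fin B × Fin h))) := by
    intro c hc
    obtain ⟨-, h1, b, h2⟩ := mem_typeClauses_singleton.1 hc
    simp only [Finset.coe_biUnion, Set.mem_iUnion]
    refine ⟨b, by simp, ?_⟩
    rw [Finset.mem_coe, Finset.mem_powersetCard]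
    refine ⟨fun l hl => ?_, h1⟩
    simp only [Finset.mem_product, Finset.mem_singleton, Finset.mem_univ, and_true]
    exact h2 l hl
  refine (Set.ncard_le_ncard hsub (Finset.finite_toSet _)).trans ?_
  rw [Set.ncard_coe_finset]
  refine (Finset.card_biUnion_le_card_mul _ _ ((2 * h) ^ k) fun b _ => ?_).trans (by simp)
  rw [Finset.card_powersetCard]
  refine (Nat.choose_le_pow _ _).trans ?_
  simp [mul_comm]

lemma le_card_typeClauses {B h k : ℕ} (hk0 : 1 ≤ k) (hk : k ≤ h) :
    B ≤ (typeClauses B h [k]).ncard := by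
  have h1 : Set.range (fun b : Fin B => signClause hk b fun _ => true) ⊆ typeClauses B h [k] := by
    rintro _ ⟨b, rfl⟩
    exact signClause_mem_typeClauses hk b _
  have h2 := Set.ncard_le_ncard h1 (Set.toFinite _)
  rwa [← Set.image_univ, Set.ncard_image_of_injective _
    (fun b b' he => (signClause_inj hk0 hk he).1), Set.ncard_univ, Nat.card_eq_fintype_card,
    Fintype.card_fin] at h2

lemma card_community_le {B h k : ℕ} (b : Fin B) :
    (typeClauses B h [k] ∩ {c | ∀ l ∈ c, l.1.1 = b}).ncard ≤ (2 * h) ^ k := by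
  classical
  have hsub : typeClauses B h [k] ∩ {c | ∀ l ∈ c, l.1.1 = b} ⊆
      ((({b} ×ˢ Finset.univ) ×ˢ Finset.univ : Finset (Literal (Fin B × Fin h))).powersetCard k :
        Finset (Clause (Fin B × Fin h))) := by
    rintro c ⟨hc, hb⟩
    obtain ⟨-, h1, -⟩ := mem_typeClauses_singleton.1 hc
    rw [Finset.mem_coe, Finset.mem_powersetCard]
    refine ⟨fun l hl => ?_, h1⟩
    simp only [Finset.mem_product, Finset.mem_singleton, Finset.mem_univ, and_true]
    exact hb l hl
  refine (Set.ncard_le_ncard hsub (Finset.finite_toSet _)).trans ?_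
  rw [Set.ncard_coe_finset, Finset.card_powersetCard]
  refine (Nat.choose_le_pow _ _).trans ?_
  simp [mul_comm]

/-! ### Finite bounds on the probability of satisfiability -/

namespace ClauseMix

variable (D : ClauseMix)

lemma isProbabilityMeasure_clauseMeasure {B h : ℕ} (hD : D.Fits B h) :
    IsProbabilityMeasure (D.clauseMeasure B h) := by
  constructor
  have : ∀ t, (uniformOn (typeClauses B h (D.K t))) Set.univ = 1 := fun t =>
    uniformOn_of_univ (Set.toFinite _) (typeClauses_nonempty (hD t).1 (hD t).2)
  simp only [clauseMeasure, Measure.coe_finsetSum, Finset.sum_apply, Measure.smul_apply, this,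
    smul_eq_mul, mul_one]
  rw [← ENNReal.ofReal_sum_of_nonneg fun t _ => D.p_nonneg t, D.p_sum, ENNReal.ofReal_one]

lemma isProbabilityMeasure_instanceMeasure {B h : ℕ} (hD : D.Fits B h) (m : ℕ) :
    IsProbabilityMeasure (D.instanceMeasure B h m) := by
  have := D.isProbabilityMeasure_clauseMeasure hD
  unfold instanceMeasure
  infer_instance

lemma unsatProb_eq {B h : ℕ} (hD : D.Fits B h) (m : ℕ) :
    D.unsatProb B h m = 1 - D.satProb B h m := by
  have := D.isProbabilityMeasure_instanceMeasure hD m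
  rw [unsatProb, satProb, ← probReal_compl_eq_one_sub (Set.toFinite _).measurableSet]
  rfl

/-- The probability that some community contains all `2 ^ k` clauses over its first `k` variables
bounds the probability of unsatisfiability from below. -/
lemma satProb_le {k : ℕ} (t₀ : Fin D.T) (ht : D.K t₀ = [k]) {B h : ℕ} (hD : D.Fits B h)
    (m s : ℕ) (hm : 2 ^ k * s ≤ m) :
    D.satProb B h m ≤
      Real.exp (-(B * (min 1 (D.p t₀ / (B * (2 * h) ^ k) * s) / 2) ^ (2 ^ k))) := by
  classical
  have := D.isProbabilityMeasure_clauseMeasure hD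
  have hk0 : 1 ≤ k := D.K_pos t₀ k (by simp [ht])
  have hk : k ≤ h := (hD t₀).2 k (by simp [ht])
  have hB : 1 ≤ B := by have := (hD t₀).1; rw [ht] at this; simpa using this
  have hp1 : D.p t₀ ≤ 1 := D.p_sum ▸
    Finset.single_le_sum (fun t _ => D.p_nonneg t) (Finset.mem_univ t₀)
  have hB' : (1 : ℝ) ≤ B := by exact_mod_cast hB
  have hh' : (1 : ℝ) ≤ h := by exact_mod_cast hk0.trans hk
  have hden : (1 : ℝ) ≤ B * (2 * h) ^ k :=
    one_le_mul_of_one_le_of_one_le hB' (one_le_pow₀ (by linarith))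
  set T : Fin B → Finset (Clause (Fin B × Fin h)) := fun b => Finset.univ.image (signClause hk b)
  have h1 := real_pi_forall_miss_le (D.clauseMeasure B h) T ?_ (2 ^ k) ?_
    (D.p t₀ / (B * (2 * h) ^ k)) (div_nonneg (D.p_nonneg _) (by linarith))
    (div_le_one_of_le₀ (hp1.trans hden) (by linarith)) ?_ m s hm
  · rw [Fintype.card_fin] at h1
    have h2 := D.isProbabilityMeasure_instanceMeasure hD m
    refine le_trans (measureReal_mono ?_) h1
    intro F hF b hb
    exact not_isSat_of_signClause hk b F (fun s => hb _ (by simp [T])) hF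
  · intro b b' hbb'
    refine Finset.disjoint_left.2 fun c hc hc' => hbb' ?_
    obtain ⟨s, -, rfl⟩ := Finset.mem_image.1 hc
    obtain ⟨s', -, hs'⟩ := Finset.mem_image.1 hc'
    exact (signClause_inj hk0 hk hs').1.symm
  · intro b
    rw [Finset.card_image_of_injective _ fun s s' he => (signClause_inj hk0 hk he).2]
    simp
  · intro b c hc
    obtain ⟨s, -, rfl⟩ := Finset.mem_image.1 hc
    have h2 : (uniformOn (typeClauses B h [k])).real {signClause hk b s} =
        1 / (typeClauses B h [k]).ncard := by
      rw [uniformOn_real, Set.inter_eq_right.2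
        (Set.singleton_subset_iff.2 (signClause_mem_typeClauses hk b s))]
      simp
    have h3 : D.p t₀ * (uniformOn (typeClauses B h [k])).real {signClause hk b s} ≤
        (D.clauseMeasure B h).real {signClause hk b s} := by
      have : ENNReal.ofReal (D.p t₀) * uniformOn (typeClauses B h [k]) {signClause hk b s} ≤
          D.clauseMeasure B h {signClause hk b s} := by
        simp only [clauseMeasure, Measure.coe_finsetSum, Finset.sum_apply, Measure.smul_apply,
          smul_eq_mul]
        rw [← ht]
        exact Finset.single_le_sum (f := fun t => ENNReal.ofReal (D.p t) *
          uniformOn (typeClauses B h (D.K t)) {signClause hk b s}) (fun _ _ => zero_le)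
          (Finset.mem_univ t₀)
      have := ENNReal.toReal_mono (measure_ne_top _ _) this
      rwa [ENNReal.toReal_mul, ENNReal.toReal_ofReal (D.p_nonneg _)] at this
    refine le_trans ?_ h3
    rw [h2, mul_one_div]
    refine div_le_div_of_nonneg_left (D.p_nonneg _) ?_ ?_
    · exact_mod_cast lt_of_lt_of_le hB (le_card_typeClauses hk0 hk)
    · exact_mod_cast card_typeClauses_le B h k

lemma clauseMeasure_eq_of_T_eq_one (hT : D.T = 1) (t : Fin D.T) (B h : ℕ) :
    D.clauseMeasure B h = uniformOn (typeClauses B h (D.K t)) := by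
  have : ∀ t', t' = t := fun t' => by
    have := t.2; have := t'.2; ext; omega
  have hu : (Finset.univ : Finset (Fin D.T)) = {t} := by ext t'; simp [this t']
  have hp := D.p_sum
  rw [hu, Finset.sum_singleton] at hp
  rw [clauseMeasure, hu, Finset.sum_singleton, hp]
  simp

/-- A formula whose clauses all have type `(k)` is satisfiable if every community contains less than
`2 ^ k` of them, and the local lemma bounds the probability of that event. -/
lemma le_satProb {k : ℕ} (hT : D.T = 1) (t₀ : Fin D.T) (ht : D.K t₀ = [k]) {B h : ℕ}
    (hD : D.Fits B h) (m : ℕ) (p : ℝ)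
    (hp : B * ((2 * h) ^ k / B : ℝ) ^ (2 ^ k) ≤ p) (hp1 : 2 * p ≤ 1)
    (hp2 : 4 * p * ((2 ^ k : ℕ) * (m : ℝ) ^ (2 ^ k - 1)) ≤ 1) :
    (1 - 2 * p) ^ (m ^ (2 ^ k)) ≤ D.satProb B h m := by
  classical
  have := D.isProbabilityMeasure_clauseMeasure hD
  have hk0 : 1 ≤ k := D.K_pos t₀ k (by simp [ht])
  have hk : k ≤ h := (hD t₀).2 k (by simp [ht])
  have hB : 1 ≤ B := by have := (hD t₀).1; rw [ht] at this; simpa using this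
  have hμ := D.clauseMeasure_eq_of_T_eq_one hT t₀ B h
  rw [ht] at hμ
  have h1 := one_sub_pow_le_real_pi_card_lt (D.clauseMeasure B h)
    (fun b : Fin B => {c | ∀ l ∈ c, l.1.1 = b}) ((2 * h) ^ k / B) ?_ (2 ^ k) m p (by simpa using hp)
    (le_trans (by positivity) hp) hp1 hp2
  · refine h1.trans ?_
    -- The law is uniform on the clauses of type `(k)`, so almost surely all clauses have that type.
    have hae : ∀ᵐ F ∂(D.instanceMeasure B h m), ∀ i, F i ∈ typeClauses B h [k] := by
      rw [ae_all_iff]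
      intro i
      have h2 : ∀ᵐ c ∂(D.clauseMeasure B h), c ∈ typeClauses B h [k] := by
        rw [hμ]
        exact ae_cond_mem (Set.toFinite _).measurableSet
      exact (measurePreserving_eval (fun _ : Fin m => D.clauseMeasure B h)
        i).quasiMeasurePreserving.ae h2
    have h3 := D.isProbabilityMeasure_instanceMeasure hD m
    refine ENNReal.toReal_mono (measure_ne_top _ _) (measure_mono_ae ?_)
    filter_upwards [hae] with F hF hS
    have h4 : ∀ b : Fin B, ∃ σ : Fin B × Fin h → Bool,
        ∀ i ∈ Finset.univ.filter (fun i => ∀ l ∈ F i, l.1.1 = b), ∃ l ∈ F i, σ l.1 = l.2 := by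
      intro b
      refine exists_assignment_of_card_lt k _ ?_ F fun i _ =>
        ⟨(mem_typeClauses_singleton.1 (hF i)).1, (mem_typeClauses_singleton.1 (hF i)).2.1⟩
      by_contra hc
      push Not at hc
      obtain ⟨S, hS1, hS2⟩ := Finset.exists_subset_card_eq hc
      obtain ⟨i, hi, hi'⟩ := hS b S hS2
      exact hi' (by simpa using hS1 hi)
    choose σ hσ using h4
    -- The communities are disjoint, so the assignments `σ b` combine to one.
    refine ⟨fun v => σ v.1 v, fun i => ?_⟩
    obtain ⟨-, -, b, hb⟩ := mem_typeClauses_singleton.1 (hF i)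
    obtain ⟨l, hl, h⟩ := hσ b i (by simpa using hb)
    exact ⟨l, hl, by simpa [hb l hl] using h⟩
  · intro b
    rw [hμ, uniformOn_real]
    have e1 : ((typeClauses B h [k] ∩ {c | ∀ l ∈ c, l.1.1 = b}).ncard : ℝ) ≤ (2 * h) ^ k := by
      exact_mod_cast card_community_le b
    have e2 : (B : ℝ) ≤ (typeClauses B h [k]).ncard := by
      exact_mod_cast le_card_typeClauses hk0 hk
    have e3 : (0 : ℝ) < B := by exact_mod_cast hB
    exact div_le_div₀ (by positivity) e1 e3 e2

end ClauseMix

/-! ### Positivity of `rStar` -/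

lemma isProbabilityMeasure_uniformOn_kClauses {n k : ℕ} (hk : k ≤ n) :
    IsProbabilityMeasure (uniformOn (kClauses n k)) := by
  refine isProbabilityMeasure_uniformOn (Set.toFinite _) ?_
  refine ⟨Finset.univ.map ⟨fun a : Fin k => (Fin.castLE hk a, true), fun a a' h => by
    simpa using h⟩, ?_, by simp⟩
  intro l hl l' hl' hll'
  simp only [Finset.coe_map, Finset.coe_univ, Set.image_univ, Set.mem_range] at hl hl'
  obtain ⟨x, rfl⟩ := hl
  obtain ⟨x', rfl⟩ := hl'
  exact Prod.ext hll' rfl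

lemma card_kClauses_le (n k : ℕ) : (kClauses n k).ncard ≤ (2 * n).choose k := by
  classical
  have hsub : kClauses n k ⊆
      ((Finset.univ : Finset (Literal (Fin n))).powersetCard k : Finset (Clause (Fin n))) :=
    fun c hc => by simpa using hc.2
  refine (Set.ncard_le_ncard hsub (Finset.finite_toSet _)).trans ?_
  rw [Set.ncard_coe_finset, Finset.card_powersetCard]
  simp [mul_comm]

/-- Each assignment falsifies at least `n.choose k` clauses. -/
lemma choose_le_card_falsified (n k : ℕ) (σ : Fin n → Bool) :
    n.choose k ≤ (kClauses n k ∩ {c | ∀ l ∈ c, σ l.1 ≠ l.2}).ncard := by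
  classical
  -- the literals made false by `σ`
  let e : Fin n ↪ Literal (Fin n) := ⟨fun v => (v, !σ v), fun a a' h => congrArg Prod.fst h⟩
  have hsub : (((Finset.univ : Finset (Fin n)).powersetCard k).image (Finset.map e) :
      Finset (Clause (Fin n))) ⊆ (kClauses n k ∩ {c | ∀ l ∈ c, σ l.1 ≠ l.2}).toFinset := by
    intro c hc
    obtain ⟨V, hV, rfl⟩ := Finset.mem_image.1 hc
    rw [Set.mem_toFinset]
    refine ⟨⟨?_, by simpa using hV⟩, ?_⟩
    · intro l hl l' hl' hll'
      obtain ⟨v, -, rfl⟩ := Finset.mem_map.1 hl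
      obtain ⟨v', -, rfl⟩ := Finset.mem_map.1 hl'
      exact congrArg e hll'
    · intro l hl
      obtain ⟨v, -, rfl⟩ := Finset.mem_map.1 hl
      change σ v ≠ !σ v
      simp
  have := Finset.card_le_card hsub
  rwa [Finset.card_image_of_injective _ (Finset.map_injective e), Finset.card_powersetCard,
    Finset.card_univ, Fintype.card_fin, ← Set.ncard_eq_toFinset_card'] at this

lemma choose_two_mul_le {n k : ℕ} (hk : 2 * k ≤ n) : (2 * n).choose k ≤ 4 ^ k * n.choose k := by
  have h1 : ((2 * n).choose k : ℝ) ≤ (2 * n : ℕ) ^ k / k.factorial :=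
    Nat.choose_le_pow_div k (2 * n)
  have h2 : ((n + 1 - k : ℕ) : ℝ) ^ k / k.factorial ≤ n.choose k := Nat.pow_le_choose k n
  have h3 : ((2 * n : ℕ) : ℝ) ≤ 4 * (n + 1 - k : ℕ) := by exact_mod_cast (by omega)
  have h4 : ((2 * n : ℕ) : ℝ) ^ k ≤ 4 ^ k * ((n + 1 - k : ℕ) : ℝ) ^ k := by
    rw [← mul_pow]
    exact pow_le_pow_left₀ (by positivity) h3 k
  have : ((2 * n).choose k : ℝ) ≤ 4 ^ k * n.choose k := by
    refine h1.trans (le_trans ?_ (mul_le_mul_of_nonneg_left h2 (by positivity)))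
    rw [← mul_div_assoc]
    gcongr
  exact_mod_cast this

/-- The first moment bound: the expected number of satisfying assignments is exponentially small at
density `4 ^ k`. -/
lemma kSat_sat_le {n k : ℕ} (hk : 2 * k ≤ n) :
    (kSatMeasure n k (4 ^ k * n)).real {F | IsSat F} ≤ (2 * Real.exp (-1)) ^ n := by
  classical
  have := isProbabilityMeasure_uniformOn_kClauses (n := n) (k := k) (by omega)
  have hσ : ∀ σ : Fin n → Bool,
      (uniformOn (kClauses n k)).real {c | ∃ l ∈ c, σ l.1 = l.2} ≤ 1 - (4 ^ k)⁻¹ := by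
    intro σ
    have h1 : ({c | ∃ l ∈ c, σ l.1 = l.2} : Set (Clause (Fin n))) =
        {c | ∀ l ∈ c, σ l.1 ≠ l.2}ᶜ := by
      ext c
      simp only [Set.mem_ofPred_eq, Set.mem_compl_iff]
      push Not
      rfl
    rw [h1, probReal_compl_eq_one_sub (Set.toFinite _).measurableSet, uniformOn_real]
    have h2 : (n.choose k : ℝ) ≤ (kClauses n k ∩ {c | ∀ l ∈ c, σ l.1 ≠ l.2}).ncard := by
      exact_mod_cast choose_le_card_falsified n k σ
    have h3 : ((kClauses n k).ncard : ℝ) ≤ 4 ^ k * n.choose k := by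
      exact_mod_cast (card_kClauses_le n k).trans (choose_two_mul_le hk)
    have h4 : 0 < (n.choose k : ℝ) := by exact_mod_cast Nat.choose_pos (by omega)
    have h5 : (0 : ℝ) < (kClauses n k).ncard := by
      have := Set.ncard_le_ncard (Set.inter_subset_left (s := kClauses n k)
        (t := {c | ∀ l ∈ c, σ l.1 ≠ l.2})) (Set.toFinite _)
      exact lt_of_lt_of_le h4 (h2.trans (by exact_mod_cast this))
    gcongr
    rw [le_div_iff₀ h5, inv_mul_le_iff₀ (by positivity)]
    exact h3.trans (mul_le_mul_of_nonneg_left h2 (by positivity))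
  have hcover : {F : Fin (4 ^ k * n) → Clause (Fin n) | IsSat F} ⊆
      ⋃ σ ∈ (Finset.univ : Finset (Fin n → Bool)),
        {F | ∀ i ∈ Finset.univ, F i ∈ ({c | ∃ l ∈ c, σ l.1 = l.2} : Set (Clause (Fin n)))} := by
    rintro F ⟨σ, hF⟩
    simp only [Set.mem_iUnion]
    exact ⟨σ, Finset.mem_univ _, fun i _ => hF i⟩
  have h1 : IsProbabilityMeasure (kSatMeasure n k (4 ^ k * n)) := by
    unfold kSatMeasure; infer_instance
  refine (measureReal_mono hcover (measure_ne_top _ _)).trans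
    ((measureReal_biUnion_finset_le _ _).trans ?_)
  have hexp : (1 - (4 ^ k : ℝ)⁻¹) ^ (4 ^ k * n) ≤ Real.exp (-1) ^ n := by
    calc (1 - (4 ^ k : ℝ)⁻¹) ^ (4 ^ k * n) ≤ Real.exp (-(4 ^ k : ℝ)⁻¹) ^ (4 ^ k * n) := by
          refine pow_le_pow_left₀ (sub_nonneg.2 (inv_le_one_of_one_le₀ ?_))
            (Real.one_sub_le_exp_neg _) _
          exact one_le_pow₀ (by norm_num)
      _ = Real.exp (-1) ^ n := by
          rw [pow_mul, ← Real.exp_nat_mul]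
          push_cast
          rw [mul_neg, mul_inv_cancel₀ (by positivity)]
  calc _ ≤ ∑ _σ : Fin n → Bool, Real.exp (-1) ^ n := by
        refine Finset.sum_le_sum fun σ _ => le_trans ?_ hexp
        rw [kSatMeasure, real_pi_forall_mem_finset, Finset.card_univ, Fintype.card_fin]
        exact pow_le_pow_left₀ measureReal_nonneg (hσ σ) _
    _ = _ := by simp [mul_pow]

/-- The clauses with all variables in `W` form a fraction of at most `16 (|W| / n) ^ 2` of all. -/
lemma uniformOn_kClauses_vars_subset_le {n k : ℕ} (hk : 2 ≤ k) (hkn : 2 * k ≤ n)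
    (W : Finset (Fin n)) :
    (uniformOn (kClauses n k)).real {c | ∀ l ∈ c, l.1 ∈ W} ≤ 16 * ((W.card : ℝ) / n) ^ 2 := by
  classical
  have := isProbabilityMeasure_uniformOn_kClauses (n := n) (k := k) (by omega)
  have hn : (0 : ℝ) < n := by exact_mod_cast (by omega)
  set y : ℝ := 4 * (W.card / n) with hy
  have hy0 : 0 ≤ y := by positivity
  -- The fraction is at most `min 1 y ^ k`, and `k ≥ 2`.
  suffices h : (uniformOn (kClauses n k)).real {c | ∀ l ∈ c, l.1 ∈ W} ≤ y ^ 2 by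
    refine h.trans_eq ?_
    rw [hy]; ring
  rcases le_total 1 y with h1 | h1
  · exact measureReal_le_one.trans (one_le_pow₀ h1)
  refine le_trans ?_ (pow_le_pow_of_le_one hy0 h1 hk)
  rw [uniformOn_real]
  have e1 : ((kClauses n k ∩ {c | ∀ l ∈ c, l.1 ∈ W}).ncard : ℝ) ≤
      ((2 * W.card : ℕ) : ℝ) ^ k / k.factorial := by
    have hsub : kClauses n k ∩ {c | ∀ l ∈ c, l.1 ∈ W} ⊆
        ((W ×ˢ Finset.univ : Finset (Literal (Fin n))).powersetCard k :
          Finset (Clause (Fin n))) := by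
      rintro c ⟨hc, hW⟩
      rw [Finset.mem_coe, Finset.mem_powersetCard]
      refine ⟨fun l hl => ?_, hc.2⟩
      simp only [Finset.mem_product, Finset.mem_univ, and_true]
      exact hW l hl
    have h2 := Set.ncard_le_ncard hsub (Finset.finite_toSet _)
    rw [Set.ncard_coe_finset, Finset.card_powersetCard, Finset.card_product, Finset.card_univ,
      Fintype.card_bool, mul_comm] at h2
    exact le_trans (by exact_mod_cast h2) (Nat.choose_le_pow_div k (2 * W.card))
  have e2 : ((n / 2 : ℝ)) ^ k / k.factorial ≤ (kClauses n k).ncard := by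
    have h2 : n.choose k ≤ (kClauses n k).ncard :=
      (choose_le_card_falsified n k fun _ => true).trans
        (Set.ncard_le_ncard Set.inter_subset_left (Set.toFinite _))
    refine le_trans ?_ ((Nat.pow_le_choose k n).trans (by exact_mod_cast h2))
    have : (n / 2 : ℝ) ≤ (n + 1 - k : ℕ) := by
      rw [div_le_iff₀ two_pos]
      exact_mod_cast (by omega)
    gcongr
  refine (div_le_div₀ (by positivity) e1 (by positivity) e2).trans_eq ?_
  rw [div_div_div_cancel_right₀ (by positivity), ← div_pow, hy]
  congr 1
  push_cast
  field_simp
  ring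

/-- A formula whose clauses have a system of distinct representatives among the variables is
satisfiable. By Hall's theorem, an unsatisfiable formula has `s` clauses whose variables all lie in
a set of `s - 1` variables. -/
lemma exists_vars_subset_of_not_isSat {n m : ℕ} (hmn : m ≤ n) (F : Fin m → Clause (Fin n))
    (hF : ¬ IsSat F) :
    ∃ s : Finset (Fin m), s.Nonempty ∧ ∃ W : Finset (Fin n), W.card = s.card - 1 ∧
      ∀ i ∈ s, ∀ l ∈ F i, l.1 ∈ W := by
  classical
  by_contra hc
  push Not at hc
  refine hF ?_
  obtain ⟨g, hg1, hg2⟩ := (Finset.all_card_le_biUnion_card_iff_exists_injective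
    (fun i => (F i).image Prod.fst)).1 (by
      intro s
      by_contra hs
      push Not at hs
      have hs0 : s.Nonempty := Finset.card_pos.1 (by omega)
      have hsm : s.card ≤ m := by simpa using s.card_le_univ
      obtain ⟨W, hW1, hW2⟩ := Finset.exists_superset_card_eq (n := s.card - 1)
        (s := s.biUnion fun i => (F i).image Prod.fst) (by omega) (by
          rw [Fintype.card_fin]; omega)
      obtain ⟨i, hi, l, hl, h⟩ := hc s hs0 W hW2
      exact h (hW1 (Finset.mem_biUnion.2 ⟨i, hi, Finset.mem_image_of_mem _ hl⟩)))
  have hlit : ∀ i, ∃ b, (g i, b) ∈ F i := by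
    intro i
    obtain ⟨l, hl, h⟩ := Finset.mem_image.1 (hg2 i)
    exact ⟨l.2, by rwa [← h]⟩
  choose b hb using hlit
  refine ⟨fun v => if h : ∃ i, g i = v then b h.choose else true, fun i => ⟨_, hb i, ?_⟩⟩
  have h : ∃ j, g j = g i := ⟨i, rfl⟩
  simp only [dif_pos h]
  rw [hg1 h.choose_spec]

/-- The contribution of the sets of `s` clauses to the union bound over violations of Hall's
condition. With `a ^ b / b! ≤ exp a` for the binomial coefficients it is at most
`(16 e² / 1024) ^ s`; this is where the density `1 / 1024` comes from. -/
lemma hall_term_le {n m s : ℕ} (hn : 1 ≤ n) (hmn : 1024 * m ≤ n) (hs1 : 1 ≤ s) (hsm : s ≤ m) :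
    (m.choose s : ℝ) * n.choose (s - 1) * (16 * (((s - 1 : ℕ) : ℝ) / n) ^ 2) ^ s ≤ (1 / 4) ^ s := by
  obtain ⟨w, rfl⟩ : ∃ w, s = w + 1 := ⟨s - 1, by omega⟩
  simp only [Nat.add_sub_cancel]
  have hn0 : (0 : ℝ) < n := by exact_mod_cast hn
  have h1 : (m.choose (w + 1) : ℝ) ≤ (n / 1024) ^ (w + 1) / (w + 1).factorial := by
    refine (Nat.choose_le_pow_div _ _).trans ?_
    have : (m : ℝ) ≤ n / 1024 := by
      rw [le_div_iff₀ (by norm_num), mul_comm]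
      exact_mod_cast hmn
    gcongr
  have h2 : (n.choose w : ℝ) ≤ n ^ w / w.factorial := Nat.choose_le_pow_div _ _
  have h3 : (w : ℝ) ^ (w + 1) / (w + 1).factorial ≤ Real.exp 1 ^ w := by
    rw [← Real.exp_nat_mul, mul_one]
    exact Real.pow_div_factorial_le_exp _ (by positivity) _
  have h4 : (w : ℝ) ^ w / w.factorial ≤ Real.exp 1 ^ w := by
    rw [← Real.exp_nat_mul, mul_one]
    exact Real.pow_div_factorial_le_exp _ (by positivity) _
  have h5 : (w : ℝ) / n ≤ 1 := by
    rw [div_le_one hn0]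
    exact_mod_cast (by omega)
  have he : Real.exp 1 ≤ 3 := Real.exp_one_lt_three.le
  have h6 : Real.exp 1 ^ w ≤ 3 ^ (w + 1) :=
    (pow_le_pow_left₀ (Real.exp_pos _).le he w).trans
      (pow_le_pow_right₀ (by norm_num) (Nat.le_succ w))
  calc (m.choose (w + 1) : ℝ) * n.choose w * (16 * ((w : ℝ) / n) ^ 2) ^ (w + 1)
      ≤ ((n / 1024) ^ (w + 1) / (w + 1).factorial) * (n ^ w / w.factorial) *
        (16 * ((w : ℝ) / n) ^ 2) ^ (w + 1) := by gcongr
    _ = (16 / 1024) ^ (w + 1) * ((w : ℝ) ^ (w + 1) / (w + 1).factorial) *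
        ((w : ℝ) ^ w / w.factorial) * (w / n) := by
        rw [mul_pow, ← pow_mul, div_pow, div_pow, div_pow]
        field_simp
        ring
    _ ≤ (16 / 1024) ^ (w + 1) * 3 ^ (w + 1) * 3 ^ (w + 1) * 1 := by
        gcongr
        · exact h3.trans h6
        · exact h4.trans h6
    _ = (9 / 64) ^ (w + 1) := by rw [mul_one, ← mul_pow, ← mul_pow]; norm_num
    _ ≤ _ := pow_le_pow_left₀ (by norm_num) (by norm_num) _

/-- Below density `1 / 1024`, random `k`-SAT is not UNSAT w.h.p. -/
lemma kSat_unsat_le {n k m : ℕ} (hk : 2 ≤ k) (hkn : 2 * k ≤ n) (hmn : 1024 * m ≤ n) :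
    (kSatMeasure n k m).real {F | ¬ IsSat F} ≤ 1 / 3 := by
  classical
  have := isProbabilityMeasure_uniformOn_kClauses (n := n) (k := k) (by omega)
  have h1 : IsProbabilityMeasure (kSatMeasure n k m) := by
    unfold kSatMeasure; infer_instance
  set E : Finset (Fin m) × Finset (Fin n) → Set (Fin m → Clause (Fin n)) := fun x =>
    {F | ∀ i ∈ x.1, F i ∈ ({c | ∀ l ∈ c, l.1 ∈ x.2} : Set (Clause (Fin n)))} with hE
  set P : ℕ → Finset (Finset (Fin m) × Finset (Fin n)) := fun s =>
    (Finset.univ.powersetCard s) ×ˢ (Finset.univ.powersetCard (s - 1)) with hP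
  have hcover : {F : Fin m → Clause (Fin n) | ¬ IsSat F} ⊆
      ⋃ s ∈ Finset.Icc 1 m, ⋃ x ∈ P s, E x := by
    intro F hF
    obtain ⟨s, hs, W, hW, h⟩ := exists_vars_subset_of_not_isSat (by omega) F hF
    have hsm : s.card ≤ m := by simpa using s.card_le_univ
    simp only [Set.mem_iUnion]
    exact ⟨s.card, Finset.mem_Icc.2 ⟨hs.card_pos, hsm⟩, (s, W), by simp [hP, hW], h⟩
  have hterm : ∀ s ∈ Finset.Icc 1 m,
      (kSatMeasure n k m).real (⋃ x ∈ P s, E x) ≤ (1 / 4) ^ s := by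
    intro s hs
    obtain ⟨hs1, hs2⟩ := Finset.mem_Icc.1 hs
    refine le_trans ?_ (hall_term_le (n := n) (by omega) hmn hs1 hs2)
    refine (measureReal_biUnion_finset_le _ _).trans ?_
    have hcard : ((P s).card : ℝ) = m.choose s * n.choose (s - 1) := by
      simp [hP, Finset.card_product]
    rw [← hcard, ← nsmul_eq_mul]
    refine Finset.sum_le_card_nsmul _ _ _ fun x hx => ?_
    simp only [hP, Finset.mem_product, Finset.mem_powersetCard_univ] at hx
    rw [hE, kSatMeasure, real_pi_forall_mem_finset, hx.1, ← hx.2]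
    exact pow_le_pow_left₀ measureReal_nonneg (uniformOn_kClauses_vars_subset_le hk hkn x.2) _
  have hgeom : ∑ s ∈ Finset.Icc 1 m, (1 / 4 : ℝ) ^ s ≤ 1 / 3 := by
    have h2 : ∀ r : ℕ, ∑ s ∈ Finset.Icc 1 r, (1 / 4 : ℝ) ^ s = (1 - (1 / 4) ^ r) / 3 := by
      intro r
      induction r with
      | zero => simp
      | succ r ih =>
        rw [Finset.sum_Icc_succ_top (by omega), ih]
        ring
    rw [h2]
    have : (0 : ℝ) ≤ (1 / 4) ^ m := by positivity
    linarith
  exact (measureReal_mono hcover (measure_ne_top _ _)).trans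
    ((measureReal_biUnion_finset_le _ _).trans ((Finset.sum_le_sum hterm).trans hgeom))

lemma kSatUnsatWhp_four_pow (k : ℕ) : KSatUnsatWhp k (4 ^ k) := by
  have hlim : Tendsto (fun n : ℕ => 1 - (2 * Real.exp (-1)) ^ n) atTop (𝓝 1) := by
    have h2 : 2 * Real.exp (-1) < 1 := by
      rw [Real.exp_neg, ← div_eq_mul_inv, div_lt_one (Real.exp_pos _)]
      linarith [Real.add_one_lt_exp (one_ne_zero (α := ℝ))]
    simpa using (tendsto_pow_atTop_nhds_zero_of_lt_one (by positivity) h2).const_sub 1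
  refine tendsto_of_tendsto_of_tendsto_of_le_of_le' hlim tendsto_const_nhds ?_ ?_
  all_goals
    filter_upwards [eventually_ge_atTop (2 * k)] with n hn
    have := isProbabilityMeasure_uniformOn_kClauses (n := n) (k := k) (by omega)
    have hfl : ⌊(4 ^ k : ℝ) * n⌋₊ = 4 ^ k * n := by
      rw [show (4 ^ k : ℝ) * n = ((4 ^ k * n : ℕ) : ℝ) by push_cast; ring, Nat.floor_natCast]
    have h1 : IsProbabilityMeasure (kSatMeasure n k (4 ^ k * n)) := by
      unfold kSatMeasure; infer_instance
    rw [hfl]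
  · have h3 : (kSatMeasure n k (4 ^ k * n)).real {F | ¬ IsSat F} =
        1 - (kSatMeasure n k (4 ^ k * n)).real {F | IsSat F} := by
      rw [← probReal_compl_eq_one_sub (Set.toFinite _).measurableSet]
      rfl
    rw [h3]
    linarith [kSat_sat_le hn]
  · exact measureReal_le_one

/-- The set of densities that defines `rStar` contains `4 ^ k`, so that its infimum is not the junk
value of an empty set, and it contains no density below `1 / 1024`. -/
lemma rStar_pos {k : ℕ} (hk : 2 ≤ k) : 0 < rStar k := by
  refine lt_of_lt_of_le (by norm_num : (0 : ℝ) < 1 / 1024)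
    (le_csInf ⟨_, kSatUnsatWhp_four_pow k⟩ fun α hα => ?_)
  by_contra hlt
  push Not at hlt
  have h1 : ∀ᶠ n : ℕ in atTop,
      (kSatMeasure n k ⌊α * (n : ℝ)⌋₊).real {F | ¬ IsSat F} ≤ 1 / 3 := by
    filter_upwards [eventually_ge_atTop (2 * k)] with n hn
    refine kSat_unsat_le hk hn ?_
    have h2 : ⌊α * (n : ℝ)⌋₊ ≤ n / 1024 := by
      rw [← Nat.floor_div_eq_div (K := ℝ)]
      refine Nat.floor_le_floor ?_
      push_cast
      rw [div_eq_inv_mul]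
      exact mul_le_mul_of_nonneg_right (by linarith) (Nat.cast_nonneg n)
    omega
  have := le_of_tendsto hα h1
  norm_num at this

/-! ### Asymptotics along sequences of models -/

namespace ClauseMix

variable {D : ClauseMix}

lemma satProb_le_one {B h : ℕ} (hD : D.Fits B h) (m : ℕ) : D.satProb B h m ≤ 1 := by
  have := D.isProbabilityMeasure_instanceMeasure hD m
  exact measureReal_le_one

/-- Up to constants and powers of `h`, the expected number of communities that contain all `2 ^ k`
clauses over their first `k` variables is the minimum of `B` and `m ^ N / n ^ (N - 1)`, where
`N = 2 ^ k`. -/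
lemma satProb_le_exp {k : ℕ} (t₀ : Fin D.T) (ht : D.K t₀ = [k]) {n B h : ℕ} (hD : D.Fits B h)
    (hn : n = B * h) (m : ℕ) (hm : 2 ^ k ≤ m) :
    D.satProb B h m ≤ Real.exp (-((D.p t₀ / (4 * 2 ^ k * 2 ^ k)) ^ (2 ^ k) *
      min (B : ℝ) ((m : ℝ) ^ (2 ^ k) / ((n : ℝ) ^ (2 ^ k - 1) * (h : ℝ) ^ (k * 2 ^ k))))) := by
  have hk0 : 1 ≤ k := D.K_pos t₀ k (by simp [ht])
  have hk : k ≤ h := (hD t₀).2 k (by simp [ht])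
  have hB : 1 ≤ B := by have := (hD t₀).1; rw [ht] at this; simpa using this
  have hp1 : D.p t₀ ≤ 1 := D.p_sum ▸
    Finset.single_le_sum (fun t _ => D.p_nonneg t) (Finset.mem_univ t₀)
  have hp0 := D.p_nonneg t₀
  have hB0 : (0 : ℝ) < B := by exact_mod_cast hB
  have hh0 : (1 : ℝ) ≤ h := by exact_mod_cast hk0.trans hk
  refine (D.satProb_le t₀ ht hD m (m / 2 ^ k) (Nat.mul_div_le _ _)).trans
    (Real.exp_le_exp.2 (neg_le_neg ?_))
  set N := 2 ^ k with hN
  have hN1 : 1 ≤ N := Nat.one_le_two_pow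
  have hNr : (2 : ℝ) ^ k = N := by simp [hN]
  have hN0 : (1 : ℝ) ≤ N := by exact_mod_cast hN1
  rw [hNr]
  set s := m / N with hs
  -- Rounding costs at most a factor `2`, because `m ≥ N`.
  have hsm : (m : ℝ) / (2 * N) ≤ s := by
    rw [div_le_iff₀ (by positivity)]
    have h1 : m < (s + 1) * N := Nat.lt_mul_of_div_lt (Nat.lt_succ_self _) hN1
    have h2 : 1 ≤ s := (Nat.one_le_div_iff hN1).2 hm
    exact_mod_cast (by nlinarith : m ≤ s * (2 * N))
  set a := D.p t₀ / (4 * N * N) with ha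
  have ha0 : 0 ≤ a := by positivity
  have ha1 : a ≤ 1 / 2 := by
    rw [ha, div_le_iff₀ (by positivity)]
    nlinarith
  have hx : a * (m / (B * (h : ℝ) ^ k)) ≤ D.p t₀ / (B * (2 * h) ^ k) * s / 2 := by
    calc a * (m / (B * (h : ℝ) ^ k)) = D.p t₀ / (B * (2 * h) ^ k) * (m / (2 * N)) / 2 := by
          rw [ha, mul_pow, hNr]
          field_simp
          ring
      _ ≤ _ := by gcongr
  rcases le_total 1 (D.p t₀ / (B * (2 * h) ^ k) * s) with h1 | h1
  · rw [min_eq_left h1, mul_comm (B : ℝ)]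
    exact mul_le_mul (pow_le_pow_left₀ ha0 ha1 N) (min_le_left _ _)
      (le_min hB0.le (by positivity)) (by positivity)
  · rw [min_eq_right h1]
    have h2 := pow_le_pow_left₀ (by positivity) hx N
    refine le_trans ?_ (mul_le_mul_of_nonneg_left h2 hB0.le)
    rw [mul_pow, mul_left_comm]
    refine mul_le_mul_of_nonneg_left ((min_le_right _ _).trans ?_) (by positivity)
    have h3 : (B : ℝ) * (m / (B * (h : ℝ) ^ k)) ^ N =
        (m : ℝ) ^ N / ((B : ℝ) ^ (N - 1) * (h : ℝ) ^ (k * N)) := by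
      obtain ⟨M, hM⟩ : ∃ M, N = M + 1 := ⟨N - 1, by omega⟩
      rw [hM, Nat.add_sub_cancel, div_pow, mul_pow, ← pow_mul, pow_succ (B : ℝ)]
      field_simp
    rw [h3]
    have h4 : (B : ℝ) ≤ n := by
      rw [hn]; exact_mod_cast Nat.le_mul_of_pos_right B (by omega)
    gcongr

section Sequences

variable {n B h m : ℕ → ℕ} {k : ℕ}

lemma IsModelSequence.tendsto_cast (hs : D.IsModelSequence n B h) :
    Tendsto (fun j => (n j : ℝ)) atTop atTop :=
  tendsto_natCast_atTop_atTop.comp hs.tendsto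

lemma tendsto_unsatProb_of_satProb (hs : D.IsModelSequence n B h)
    (hsat : Tendsto (fun j => D.satProb (B j) (h j) (m j)) atTop (𝓝 0)) :
    Tendsto (fun j => D.unsatProb (B j) (h j) (m j)) atTop (𝓝 1) := by
  have := hsat.const_sub 1
  rw [sub_zero] at this
  exact this.congr fun j => (D.unsatProb_eq (hs.fits j) (m j)).symm

/-- UNSAT w.h.p. as soon as the bound of `satProb_le_exp` tends to zero. -/
lemma tendsto_unsatProb (hs : D.IsModelSequence n B h) (t₀ : Fin D.T) (ht : D.K t₀ = [k])
    (hp : 0 < D.p t₀) (hm : ∀ᶠ j in atTop, 2 ^ k ≤ m j)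
    (hB : Tendsto (fun j => (B j : ℝ)) atTop atTop)
    (hX : Tendsto (fun j => (m j : ℝ) ^ (2 ^ k) /
      ((n j : ℝ) ^ (2 ^ k - 1) * (h j : ℝ) ^ (k * 2 ^ k))) atTop atTop) :
    Tendsto (fun j => D.unsatProb (B j) (h j) (m j)) atTop (𝓝 1) := by
  refine tendsto_unsatProb_of_satProb hs ?_
  have hmin : Tendsto (fun j => min (B j : ℝ) ((m j : ℝ) ^ (2 ^ k) /
      ((n j : ℝ) ^ (2 ^ k - 1) * (h j : ℝ) ^ (k * 2 ^ k)))) atTop atTop := by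
    refine tendsto_atTop.2 fun b => ?_
    filter_upwards [hB.eventually_ge_atTop b, hX.eventually_ge_atTop b] with j h1 h2
    exact le_min h1 h2
  have h1 := Real.tendsto_exp_atBot.comp (tendsto_neg_atTop_atBot.comp
    (Tendsto.const_mul_atTop (by positivity : 0 < (D.p t₀ / (4 * 2 ^ k * 2 ^ k)) ^ (2 ^ k))
      hmin))
  refine squeeze_zero' (Eventually.of_forall fun j => measureReal_nonneg) ?_ h1
  filter_upwards [hm] with j hj
  exact satProb_le_exp t₀ ht (hs.fits j) (hs.size j) (m j) hj

/-- Every positive power dominates every power of the logarithm. -/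
lemma tendsto_rpow_div_log_rpow {s : ℝ} (hs : 0 < s) (r : ℝ) :
    Tendsto (fun x : ℝ => x ^ s / Real.log x ^ r) atTop atTop := by
  have h1 := (isLittleO_log_rpow_rpow_atTop r hs).tendsto_div_nhds_zero
  have h2 : Tendsto (fun x : ℝ => Real.log x ^ r / x ^ s) atTop (𝓝[>] 0) := by
    refine tendsto_nhdsWithin_iff.2 ⟨h1, ?_⟩
    filter_upwards [eventually_gt_atTop 1] with x hx
    have := Real.log_pos hx
    have : 0 < x := by linarith
    exact Set.mem_Ioi.2 (by positivity)
  refine h2.inv_tendsto_nhdsGT_zero.congr fun x => ?_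
  simp

lemma tendsto_communities (hs : D.IsModelSequence n B h) {C : ℝ}
    (hh : ∀ᶠ j in atTop, (h j : ℝ) ≤ C * Real.log (n j)) :
    Tendsto (fun j => (B j : ℝ)) atTop atTop := by
  have h1 : Tendsto (fun j => (n j : ℝ) / Real.log (n j)) atTop atTop := by
    refine ((tendsto_rpow_div_log_rpow zero_lt_one 1).comp hs.tendsto_cast).congr fun j => ?_
    simp
  refine tendsto_atTop_mono' _ ?_ (h1.const_mul_atTop (by positivity : 0 < (max C 1)⁻¹))
  filter_upwards [hh, hs.tendsto_cast.eventually_gt_atTop 1] with j hj hj1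
  have hL := Real.log_pos hj1
  have h2 : (h j : ℝ) ≤ max C 1 * Real.log (n j) :=
    hj.trans (mul_le_mul_of_nonneg_right (le_max_left _ _) hL.le)
  have hC : 0 < max C 1 := by positivity
  rw [inv_mul_le_iff₀ hC, div_le_iff₀ hL, hs.size j]
  push_cast
  calc (B j : ℝ) * h j ≤ B j * (max C 1 * Real.log (n j)) := by gcongr
    _ = max C 1 * B j * Real.log (↑(B j) * ↑(h j)) := by rw [hs.size j]; push_cast; ring

/-- UNSAT w.h.p. for logarithmic communities and `m ≥ c n ^ (1 - γ) / ln ^ θ n` with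
`γ < 2 ^ (-k)`: powers of `ln n` are negligible. -/
lemma tendsto_unsatProb_of_log (hs : D.IsModelSequence n B h) (t₀ : Fin D.T) (ht : D.K t₀ = [k])
    (hp : 0 < D.p t₀) {C c γ θ : ℝ} (hc : 0 < c) (hγ : 2 ^ k * γ < 1)
    (hh : ∀ᶠ j in atTop, (h j : ℝ) ≤ C * Real.log (n j))
    (hm : ∀ᶠ j in atTop, c * ((n j : ℝ) ^ (1 - γ) / Real.log (n j) ^ θ) ≤ m j) :
    Tendsto (fun j => D.unsatProb (B j) (h j) (m j)) atTop (𝓝 1) := by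
  set N := 2 ^ k with hN
  have hN1 : 1 ≤ N := Nat.one_le_two_pow
  have hNr : (2 : ℝ) ^ k = N := by simp [hN]
  have hN0 : (1 : ℝ) ≤ N := by exact_mod_cast hN1
  rw [hNr] at hγ
  have hmtop : Tendsto (fun j => (m j : ℝ)) atTop atTop := by
    refine tendsto_atTop_mono' _ hm (Tendsto.const_mul_atTop hc ?_)
    exact (tendsto_rpow_div_log_rpow (s := 1 - γ) (by nlinarith) θ).comp hs.tendsto_cast
  refine tendsto_unsatProb hs t₀ ht hp ?_ (tendsto_communities hs hh) ?_
  · filter_upwards [hmtop.eventually_ge_atTop ((2 ^ k : ℕ) : ℝ)] with j hj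
    exact_mod_cast hj
  have h1 : Tendsto (fun j => (c ^ N / (max C 1) ^ (k * N)) * ((n j : ℝ) ^ (1 - N * γ) /
      Real.log (n j) ^ (θ * N + (k * N : ℕ)))) atTop atTop :=
    Tendsto.const_mul_atTop (by positivity)
      ((tendsto_rpow_div_log_rpow (by linarith) _).comp hs.tendsto_cast)
  refine tendsto_atTop_mono' _ ?_ h1
  filter_upwards [hh, hm, hs.tendsto_cast.eventually_gt_atTop 1] with j hj hmj hj1
  have hL := Real.log_pos hj1
  set L := Real.log (n j)
  have hn0 : (0 : ℝ) < n j := by linarith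
  have h2 : (h j : ℝ) ≤ max C 1 * L :=
    hj.trans (mul_le_mul_of_nonneg_right (le_max_left _ _) hL.le)
  have hh0 : (0 : ℝ) < h j := by
    rcases Nat.eq_zero_or_pos (h j) with h0 | h0
    · have := hs.size j
      rw [h0, mul_zero] at this
      rw [this] at hn0
      simp at hn0
    · exact_mod_cast h0
  have e1 : ((n j : ℝ) ^ (1 - γ)) ^ N = (n j : ℝ) ^ (1 - N * γ) * (n j : ℝ) ^ (N - 1) := by
    rw [← Real.rpow_natCast, ← Real.rpow_mul hn0.le, ← Real.rpow_natCast, ← Real.rpow_add hn0,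
      Nat.cast_sub hN1]
    congr 1
    push_cast
    ring
  have e2 : L ^ (θ * N + (k * N : ℕ)) = (L ^ θ) ^ N * L ^ (k * N) := by
    rw [Real.rpow_add hL, Real.rpow_mul hL.le, Real.rpow_natCast, Real.rpow_natCast]
  calc (c ^ N / (max C 1) ^ (k * N)) * ((n j : ℝ) ^ (1 - N * γ) / L ^ (θ * N + (k * N : ℕ)))
      = (c * ((n j : ℝ) ^ (1 - γ) / L ^ θ)) ^ N /
          ((n j : ℝ) ^ (N - 1) * (max C 1 * L) ^ (k * N)) := by
        rw [e2, mul_pow, div_pow, e1, mul_pow]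
        field_simp
    _ ≤ (m j : ℝ) ^ N / ((n j : ℝ) ^ (N - 1) * (h j : ℝ) ^ (k * N)) := by gcongr

/-- The exponent `1 - 1 / 2 ^ k` in terms of integer powers. -/
lemma div_rpow_pow_eq (k : ℕ) {x : ℝ} (hx : 0 < x) (y : ℝ) :
    (y / x ^ (1 - 1 / 2 ^ k : ℝ)) ^ (2 ^ k) = y ^ (2 ^ k) / x ^ (2 ^ k - 1) := by
  rw [div_pow, ← Real.rpow_natCast (x ^ _), ← Real.rpow_mul hx.le,
    ← Real.rpow_natCast x (2 ^ k - 1), Nat.cast_sub Nat.one_le_two_pow]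
  congr 2
  push_cast
  field_simp

/-- For bounded communities and a single clause type, the local lemma bound becomes
`exp (-A m ^ N / n ^ (N - 1))`, where `N = 2 ^ k`. -/
lemma exists_exp_le_satProb (hs : D.IsModelSequence n B h) (hT : D.T = 1) (t₀ : Fin D.T)
    (ht : D.K t₀ = [k]) {H C : ℝ} (hh : ∀ᶠ j in atTop, (h j : ℝ) ≤ H)
    (hm : ∀ᶠ j in atTop, (m j : ℝ) ≤ C * (n j : ℝ) ^ (1 - 1 / 2 ^ k : ℝ)) :
    ∃ A : ℝ, 0 ≤ A ∧ ∀ᶠ j in atTop,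
      Real.exp (-(A * ((m j : ℝ) / (n j : ℝ) ^ (1 - 1 / 2 ^ k : ℝ)) ^ (2 ^ k))) ≤
        D.satProb (B j) (h j) (m j) := by
  have hk0 : 1 ≤ k := D.K_pos t₀ k (by simp [ht])
  set N := 2 ^ k with hN
  obtain ⟨M, hM⟩ : ∃ M, N = M + 2 :=
    ⟨N - 2, by have : 2 ^ 1 ≤ 2 ^ k := Nat.pow_le_pow_right two_pos hk0; omega⟩
  set H' := max H 1 with hH'
  have hH0 : 0 < H' := by positivity
  set A₀ : ℝ := ((2 * H') ^ k) ^ N * H' ^ (N - 1) with hA₀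
  have hA₀0 : 0 < A₀ := by positivity
  refine ⟨4 * A₀, by positivity, ?_⟩
  have hp : Tendsto (fun j => A₀ / (n j : ℝ) ^ (N - 1)) atTop (𝓝 0) :=
    Tendsto.div_atTop tendsto_const_nhds
      ((tendsto_pow_atTop (by omega)).comp hs.tendsto_cast)
  have hmn : Tendsto (fun j => (m j : ℝ) / n j) atTop (𝓝 0) := by
    have h1 : Tendsto (fun j => C * ((n j : ℝ) ^ (-(1 / 2 ^ k : ℝ)))) atTop (𝓝 0) := by
      simpa using ((tendsto_rpow_neg_atTop (by positivity : (0 : ℝ) < 1 / 2 ^ k)).comp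
        hs.tendsto_cast).const_mul C
    refine squeeze_zero' (Eventually.of_forall fun j => by positivity) ?_ h1
    filter_upwards [hm, hs.tendsto_cast.eventually_gt_atTop 0] with j hj hn0
    rw [div_le_iff₀ hn0, mul_assoc]
    refine hj.trans_eq ?_
    rw [← Real.rpow_add_one hn0.ne']
    ring_nf
  have hq : Tendsto (fun j => 4 * A₀ * N * ((m j : ℝ) / n j) ^ (N - 1)) atTop (𝓝 0) := by
    have := (hmn.pow (N - 1)).const_mul (4 * A₀ * N)
    rwa [zero_pow (by omega), mul_zero] at this
  filter_upwards [hh, hs.tendsto_cast.eventually_gt_atTop 0,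
    hp.eventually_le_const (by norm_num : (0 : ℝ) < 1 / 4),
    hq.eventually_le_const (by norm_num : (0 : ℝ) < 1)] with j hj hn0 hpj hqj
  have hnB : (n j : ℝ) = B j * h j := by rw [hs.size j]; push_cast; ring
  have hB0 : (0 : ℝ) < B j := by
    rcases (Nat.cast_nonneg (α := ℝ) (B j)).lt_or_eq with h0 | h0
    · exact h0
    · rw [hnB, ← h0, zero_mul] at hn0
      exact absurd hn0 (lt_irrefl _)
  set p := A₀ / (n j : ℝ) ^ (N - 1) with hpdef
  have hp0 : 0 ≤ p := by positivity
  have hhH : (h j : ℝ) ≤ H' := hj.trans (le_max_left _ _)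
  have h1 : (B j : ℝ) * ((2 * h j) ^ k / B j : ℝ) ^ N ≤ p := by
    have e1 : (B j : ℝ) * ((2 * h j) ^ k / B j : ℝ) ^ N =
        ((2 * h j : ℝ) ^ k) ^ N / (B j : ℝ) ^ (N - 1) := by
      rw [hM, div_pow, pow_succ (B j : ℝ) (M + 1)]
      simp only [Nat.add_succ_sub_one]
      field_simp
    rw [e1, hpdef, hA₀, div_le_div_iff₀ (by positivity) (by positivity), mul_assoc, ← mul_pow]
    have e2 : (n j : ℝ) ≤ H' * B j := by
      rw [hnB, mul_comm]; gcongr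
    gcongr
  have h2 := D.le_satProb hT t₀ ht (hs.fits j) (m j) p h1 (by linarith) (by
    refine le_trans (le_of_eq ?_) hqj
    rw [hpdef, div_pow, ← hN]
    ring)
  refine le_trans ?_ h2
  have h3 : Real.exp (-(4 * p)) ≤ 1 - 2 * p := by
    have e1 := Real.add_one_le_exp (4 * p)
    rw [Real.exp_neg, inv_le_comm₀ (Real.exp_pos _) (by linarith)]
    refine le_trans ?_ e1
    rw [inv_le_iff_one_le_mul₀ (by linarith)]
    nlinarith
  calc _ = Real.exp (-(4 * p)) ^ (m j ^ N) := by
        rw [← Real.exp_nat_mul, div_rpow_pow_eq k hn0, hpdef]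
        congr 1
        push_cast
        ring
    _ ≤ _ := pow_le_pow_left₀ (Real.exp_pos _).le h3 _

lemma eventually_le_log_of_eventually_le (hs : D.IsModelSequence n B h) {H : ℝ}
    (hh : ∀ᶠ j in atTop, (h j : ℝ) ≤ H) :
    ∀ᶠ j in atTop, (h j : ℝ) ≤ 1 * Real.log (n j) := by
  filter_upwards [hh, (Real.tendsto_log_atTop.comp hs.tendsto_cast).eventually_ge_atTop H]
    with j h1 h2
  rw [one_mul]
  exact h1.trans h2

lemma sat_whp_of_isLittleO (hs : D.IsModelSequence n B h) (hT : D.T = 1) (t₀ : Fin D.T)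
    (ht : D.K t₀ = [k]) {H : ℝ} (hh : ∀ᶠ j in atTop, (h j : ℝ) ≤ H)
    (hm : (fun j => (m j : ℝ)) =o[atTop] (fun j => (n j : ℝ) ^ (1 - 1 / 2 ^ k : ℝ))) :
    Tendsto (fun j => D.satProb (B j) (h j) (m j)) atTop (𝓝 1) := by
  obtain ⟨A, -, hA⟩ := exists_exp_le_satProb hs hT t₀ ht (C := 1) hh (by
    filter_upwards [hm.bound one_pos] with j hj
    rwa [Real.norm_of_nonneg (by positivity), Real.norm_of_nonneg (by positivity)] at hj)
  have h1 : Tendsto (fun j => Real.exp (-(A * ((m j : ℝ) / (n j : ℝ) ^ (1 - 1 / 2 ^ k : ℝ)) ^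
      (2 ^ k)))) atTop (𝓝 1) := by
    have h2 := ((hm.tendsto_div_nhds_zero.pow (2 ^ k)).const_mul A).neg
    rw [zero_pow (by positivity), mul_zero, neg_zero] at h2
    have h3 := (Real.continuous_exp.tendsto 0).comp h2
    rw [Real.exp_zero] at h3
    exact h3
  exact tendsto_of_tendsto_of_tendsto_of_le_of_le' h1 tendsto_const_nhds hA
    (Eventually.of_forall fun j => satProb_le_one (hs.fits j) _)

/-- For `m = O (n ^ (1 - 1 / N))` the bound `exp (-A m ^ N / n ^ (N - 1))` stays away from zero. -/
lemma exists_le_satProb_of_isBigO (hs : D.IsModelSequence n B h) (hT : D.T = 1) (t₀ : Fin D.T)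
    (ht : D.K t₀ = [k]) {H : ℝ} (hh : ∀ᶠ j in atTop, (h j : ℝ) ≤ H)
    (hm : (fun j => (m j : ℝ)) =O[atTop] (fun j => (n j : ℝ) ^ (1 - 1 / 2 ^ k : ℝ))) :
    ∃ δ : ℝ, 0 < δ ∧ ∀ᶠ j in atTop, δ ≤ D.satProb (B j) (h j) (m j) := by
  obtain ⟨C, hC⟩ := hm.bound
  have hC' : ∀ᶠ j in atTop, (m j : ℝ) ≤ C * (n j : ℝ) ^ (1 - 1 / 2 ^ k : ℝ) := by
    filter_upwards [hC] with j hj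
    rwa [Real.norm_of_nonneg (by positivity), Real.norm_of_nonneg (by positivity)] at hj
  obtain ⟨A, hA0, hA⟩ := exists_exp_le_satProb hs hT t₀ ht hh hC'
  refine ⟨Real.exp (-(A * C ^ (2 ^ k))), Real.exp_pos _, ?_⟩
  filter_upwards [hA, hC', hs.tendsto_cast.eventually_gt_atTop 0] with j h1 h2 h3
  refine le_trans (Real.exp_le_exp.2 (neg_le_neg (mul_le_mul_of_nonneg_left
    (pow_le_pow_left₀ (by positivity) ?_ _) hA0))) h1
  rwa [div_le_iff₀ (by positivity)]

lemma eventually_two_pow_le (hk0 : 1 ≤ k) (hs : D.IsModelSequence n B h)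
    (hm : (fun j => (n j : ℝ) ^ (1 - 1 / 2 ^ k : ℝ)) =O[atTop] (fun j => (m j : ℝ))) :
    ∀ᶠ j in atTop, 2 ^ k ≤ m j := by
  have h1 : (0 : ℝ) < 1 - 1 / 2 ^ k := by
    rw [sub_pos, div_lt_one (by positivity)]
    exact one_lt_pow₀ one_lt_two (by omega)
  have h2 : Tendsto (fun j => ‖(n j : ℝ) ^ (1 - 1 / 2 ^ k : ℝ)‖) atTop atTop :=
    tendsto_norm_atTop_atTop.comp ((tendsto_rpow_atTop h1).comp hs.tendsto_cast)
  have h3 : Tendsto (fun j => ‖(m j : ℝ)‖) atTop atTop := by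
    obtain ⟨c, hc, hcb⟩ := hm.exists_pos
    refine tendsto_atTop_mono' _ ?_ (h2.const_mul_atTop (inv_pos.2 hc))
    filter_upwards [hcb.bound] with j hj
    rwa [inv_mul_le_iff₀ hc]
  filter_upwards [h3.eventually_ge_atTop ((2 ^ k : ℕ) : ℝ)] with j hj
  rw [Real.norm_of_nonneg (by positivity)] at hj
  exact_mod_cast hj

lemma exists_satProb_le_of_isBigO (hs : D.IsModelSequence n B h) (t₀ : Fin D.T)
    (ht : D.K t₀ = [k]) (hp : 0 < D.p t₀) {H : ℝ} (hh : ∀ᶠ j in atTop, (h j : ℝ) ≤ H)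
    (hm : (fun j => (n j : ℝ) ^ (1 - 1 / 2 ^ k : ℝ)) =O[atTop] (fun j => (m j : ℝ))) :
    ∃ δ : ℝ, 0 < δ ∧ ∀ᶠ j in atTop, D.satProb (B j) (h j) (m j) ≤ 1 - δ := by
  have hk0 : 1 ≤ k := D.K_pos t₀ k (by simp [ht])
  obtain ⟨c, hc, hcb⟩ := hm.exists_pos
  set H' := max H 1 with hH'
  set y := (D.p t₀ / (4 * 2 ^ k * 2 ^ k)) ^ (2 ^ k) *
    min 1 ((c⁻¹) ^ (2 ^ k) / H' ^ (k * 2 ^ k)) with hy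
  have hy0 : 0 < y := mul_pos (by positivity) (lt_min one_pos (by positivity))
  refine ⟨1 - Real.exp (-y),
    sub_pos.2 ((Real.exp_lt_exp.2 (neg_lt_zero.2 hy0)).trans_eq Real.exp_zero), ?_⟩
  filter_upwards [hcb.bound, hh, eventually_two_pow_le hk0 hs hm,
    hs.tendsto_cast.eventually_gt_atTop 0] with j h1 h2 h3 hn0
  rw [sub_sub_cancel]
  refine (satProb_le_exp t₀ ht (hs.fits j) (hs.size j) (m j) h3).trans
    (Real.exp_le_exp.2 (neg_le_neg (mul_le_mul_of_nonneg_left ?_ (by positivity))))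
  have hB : 1 ≤ B j := by have := (hs.fits j t₀).1; rw [ht] at this; simpa using this
  have hh1 : (0 : ℝ) < h j := by
    have := (hs.fits j t₀).2 k (by simp [ht])
    exact_mod_cast (by omega : 0 < h j)
  refine min_le_min (by exact_mod_cast hB) ?_
  rw [Real.norm_of_nonneg (by positivity), Real.norm_of_nonneg (by positivity)] at h1
  rw [← div_div, ← div_rpow_pow_eq k hn0]
  have h4 : c⁻¹ ≤ (m j : ℝ) / (n j : ℝ) ^ (1 - 1 / 2 ^ k : ℝ) := by
    rw [le_div_iff₀ (by positivity), inv_mul_le_iff₀ hc]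
    exact h1
  have h5 : (h j : ℝ) ≤ H' := h2.trans (le_max_left _ _)
  gcongr

lemma unsat_whp_of_isLittleO (hs : D.IsModelSequence n B h) (t₀ : Fin D.T)
    (ht : D.K t₀ = [k]) (hp : 0 < D.p t₀) {H : ℝ} (hh : ∀ᶠ j in atTop, (h j : ℝ) ≤ H)
    (hm : (fun j => (n j : ℝ) ^ (1 - 1 / 2 ^ k : ℝ)) =o[atTop] (fun j => (m j : ℝ))) :
    Tendsto (fun j => D.unsatProb (B j) (h j) (m j)) atTop (𝓝 1) := by
  have hk0 : 1 ≤ k := D.K_pos t₀ k (by simp [ht])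
  have hm2 := eventually_two_pow_le hk0 hs hm.isBigO
  refine tendsto_unsatProb hs t₀ ht hp hm2
    (tendsto_communities hs (eventually_le_log_of_eventually_le hs hh)) ?_
  have h1 : Tendsto (fun j => (m j : ℝ) / (n j : ℝ) ^ (1 - 1 / 2 ^ k : ℝ)) atTop atTop := by
    have h2 : Tendsto (fun j => (n j : ℝ) ^ (1 - 1 / 2 ^ k : ℝ) / (m j : ℝ)) atTop (𝓝[>] 0) := by
      refine tendsto_nhdsWithin_iff.2 ⟨hm.tendsto_div_nhds_zero, ?_⟩
      filter_upwards [hm2, hs.tendsto_cast.eventually_gt_atTop 0] with j h3 h4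
      have : (0 : ℝ) < m j := by exact_mod_cast lt_of_lt_of_le (by positivity) h3
      exact div_pos (by positivity) this
    refine h2.inv_tendsto_nhdsGT_zero.congr fun j => ?_
    simp
  have h2 : Tendsto (fun j => ((m j : ℝ) / (n j : ℝ) ^ (1 - 1 / 2 ^ k : ℝ)) ^ (2 ^ k) /
      (max H 1) ^ (k * 2 ^ k)) atTop atTop :=
    ((tendsto_pow_atTop (by positivity)).comp h1).atTop_div_const (by positivity)
  refine tendsto_atTop_mono' _ ?_ h2
  filter_upwards [hh, hs.tendsto_cast.eventually_gt_atTop 0] with j h3 hn0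
  rw [← div_div, ← div_rpow_pow_eq k hn0]
  have hh1 : (0 : ℝ) < h j := by
    have := (hs.fits j t₀).2 k (by simp [ht])
    exact_mod_cast (by omega : 0 < h j)
  have h5 : (h j : ℝ) ≤ max H 1 := h3.trans (le_max_left _ _)
  gcongr

lemma unsat_whp_of_log_div_loglog (hs : D.IsModelSequence n B h) (t₀ : Fin D.T)
    (ht : D.K t₀ = [k]) (hp : 0 < D.p t₀)
    (hh : (fun j => (h j : ℝ)) =o[atTop]
      (fun j => Real.log (n j) / Real.log (Real.log (n j)))) {θ : ℝ}
    (hm : (fun j => (n j : ℝ) / Real.log (n j) ^ θ) =O[atTop] (fun j => (m j : ℝ))) :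
    Tendsto (fun j => D.unsatProb (B j) (h j) (m j)) atTop (𝓝 1) := by
  have hlog := Real.tendsto_log_atTop.comp hs.tendsto_cast
  obtain ⟨c, hc, hcb⟩ := hm.exists_pos
  refine tendsto_unsatProb_of_log hs t₀ ht hp (C := 1) (c := c⁻¹) (γ := 0) (θ := θ)
    (inv_pos.2 hc) (by simp) ?_ ?_
  · filter_upwards [hh.bound one_pos, hlog.eventually_gt_atTop 0,
      (Real.tendsto_log_atTop.comp hlog).eventually_ge_atTop 1] with j h1 h2 h3
    simp only [Function.comp_apply] at h2 h3
    rw [Real.norm_of_nonneg (by positivity), Real.norm_of_nonneg (by positivity)] at h1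
    exact h1.trans (mul_le_mul_of_nonneg_left (div_le_self h2.le h3) zero_le_one)
  · filter_upwards [hcb.bound, hlog.eventually_gt_atTop 0] with j h1 h2
    simp only [Function.comp_apply] at h2
    rw [Real.norm_of_nonneg (by positivity), Real.norm_of_nonneg (by positivity)] at h1
    rwa [sub_zero, Real.rpow_one, inv_mul_le_iff₀ hc]

/-- Since `h` is an integer, `2 ^ k * β < h` bounds `2 ^ k * β / h` away from `1`. -/
lemma unsat_whp_of_exp (hs : D.IsModelSequence n B h) (t₀ : Fin D.T)
    (ht : D.K t₀ = [k]) (hp : 0 < D.p t₀)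
    (hh : (fun j => (h j : ℝ)) =o[atTop] (fun j => Real.log (n j))) {β : ℝ}
    (hβ : ∀ᶠ j in atTop, 2 ^ k * β < (h j : ℝ))
    (hm : (fun j => (n j : ℝ) * Real.exp (-β * Real.log (n j) / (h j : ℝ))) =O[atTop]
      (fun j => (m j : ℝ))) :
    Tendsto (fun j => D.unsatProb (B j) (h j) (m j)) atTop (𝓝 1) := by
  have hk0 : 1 ≤ k := D.K_pos t₀ k (by simp [ht])
  have hlog := Real.tendsto_log_atTop.comp hs.tendsto_cast
  obtain ⟨c, hc, hcb⟩ := hm.exists_pos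
  set h₀ : ℝ := (⌊2 ^ k * β⌋₊ : ℝ) + 1 with hh₀
  have hh₀0 : 0 < h₀ := by positivity
  refine tendsto_unsatProb_of_log hs t₀ ht hp (C := 1) (c := c⁻¹) (γ := max β 0 / h₀) (θ := 0)
    (inv_pos.2 hc) ?_ ?_ ?_
  · rw [← mul_div_assoc, div_lt_one hh₀0, mul_max_of_nonneg _ _ (by positivity), mul_zero]
    exact max_lt (Nat.lt_floor_add_one _) hh₀0
  · filter_upwards [hh.bound one_pos, hlog.eventually_gt_atTop 0] with j h1 h2
    simp only [Function.comp_apply] at h2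
    rwa [Real.norm_of_nonneg (by positivity), Real.norm_of_nonneg (by positivity)] at h1
  · filter_upwards [hcb.bound, hlog.eventually_gt_atTop 0, hβ,
      hs.tendsto_cast.eventually_gt_atTop 0] with j h1 h2 h3 hn0
    simp only [Function.comp_apply] at h2
    have hh1 : 0 < h j := by
      have := (hs.fits j t₀).2 k (by simp [ht])
      omega
    rw [Real.norm_of_nonneg (by positivity), Real.norm_of_nonneg (by positivity)] at h1
    rw [Real.rpow_zero, div_one, inv_mul_le_iff₀ hc]
    refine le_trans ?_ h1
    rw [Real.rpow_sub hn0, Real.rpow_one, div_eq_mul_inv, ← Real.rpow_neg hn0.le,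
      Real.rpow_def_of_pos hn0]
    refine mul_le_mul_of_nonneg_left (Real.exp_le_exp.2 ?_) hn0.le
    have h4 : h₀ ≤ h j := by
      have : ⌊2 ^ k * β⌋₊ < h j := (Nat.floor_lt' hh1.ne').2 h3
      rw [hh₀]
      exact_mod_cast this
    have h5 : β / h j ≤ max β 0 / h₀ :=
      (div_le_div_of_nonneg_right (le_max_left β 0) (by positivity)).trans
        (div_le_div_of_nonneg_left (le_max_right _ _) hh₀0 h4)
    calc Real.log (n j) * -(max β 0 / h₀) ≤ Real.log (n j) * -(β / h j) :=
          mul_le_mul_of_nonneg_left (neg_le_neg h5) h2.le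
      _ = _ := by ring

lemma unsat_whp_of_linear (hs : D.IsModelSequence n B h) (t₀ : Fin D.T)
    (ht : D.K t₀ = [k]) (hp : 0 < D.p t₀) {C α : ℝ} (hα : 0 < α)
    (hh : ∀ᶠ j in atTop, (h j : ℝ) ≤ C * Real.log (n j))
    (hm : ∀ j, |(m j : ℝ) - α * (n j : ℝ)| < 1) :
    Tendsto (fun j => D.unsatProb (B j) (h j) (m j)) atTop (𝓝 1) := by
  refine tendsto_unsatProb_of_log hs t₀ ht hp (C := C) (c := α / 2) (γ := 0) (θ := 0)
    (by positivity) (by simp) hh ?_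
  filter_upwards [hs.tendsto_cast.eventually_ge_atTop (2 / α)] with j h1
  have h2 := (abs_lt.1 (hm j)).1
  rw [div_le_iff₀ hα] at h1
  rw [sub_zero, Real.rpow_one, Real.rpow_zero, div_one]
  linarith

end Sequences

end ClauseMix

theorem mainTheorem1 (k : ℕ) :
    (∀ (D : ClauseMix) (t₀ : Fin D.T), D.K t₀ = [k] → 0 < D.p t₀ →
      ∀ n B h m : ℕ → ℕ, D.IsModelSequence n B h →
        -- part (a)
        ((fun j => (h j : ℝ)) =O[atTop] (fun _ => (1 : ℝ)) →
          -- (i)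
          (D.T = 1 →
            (fun j => (m j : ℝ)) =o[atTop] (fun j => (n j : ℝ) ^ (1 - 1 / 2 ^ k : ℝ)) →
            Tendsto (fun j => D.satProb (B j) (h j) (m j)) atTop (𝓝 1)) ∧
          -- (ii)
          ((fun j => (m j : ℝ)) =Θ[atTop] (fun j => (n j : ℝ) ^ (1 - 1 / 2 ^ k : ℝ)) →
            (∃ δ : ℝ, 0 < δ ∧ ∀ᶠ j in atTop, D.satProb (B j) (h j) (m j) ≤ 1 - δ) ∧
            (D.T = 1 →
              ∃ δ : ℝ, 0 < δ ∧ ∀ᶠ j in atTop, δ ≤ D.satProb (B j) (h j) (m j) ∧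
                D.satProb (B j) (h j) (m j) ≤ 1 - δ)) ∧
          -- (iii)
          ((fun j => (n j : ℝ) ^ (1 - 1 / 2 ^ k : ℝ)) =o[atTop] (fun j => (m j : ℝ)) →
            Tendsto (fun j => D.unsatProb (B j) (h j) (m j)) atTop (𝓝 1))) ∧
        -- part (b)
        ((fun j => (h j : ℝ)) =o[atTop]
            (fun j => Real.log (n j) / Real.log (Real.log (n j))) →
          (∃ θ : ℝ, (fun j => (n j : ℝ) / Real.log (n j) ^ θ) =O[atTop] (fun j => (m j : ℝ))) →
          Tendsto (fun j => D.unsatProb (B j) (h j) (m j)) atTop (𝓝 1)) ∧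
        -- part (c)
        (2 ≤ k →
          (fun j => (h j : ℝ)) =o[atTop] (fun j => Real.log (n j)) →
          (∃ β : ℝ, β < 1 / rStar k ∧ (∀ᶠ j in atTop, 2 ^ k * β < (h j : ℝ)) ∧
            (fun j => (n j : ℝ) * Real.exp (-β * Real.log (n j) / (h j : ℝ))) =O[atTop]
              (fun j => (m j : ℝ))) →
          Tendsto (fun j => D.unsatProb (B j) (h j) (m j)) atTop (𝓝 1))) ∧
    -- part (d); `ε₀` depends only on `k` and on the implicit constant `C` in `h = O(ln n)`
    (2 ≤ k → ∀ C : ℝ, ∃ ε₀ : ℝ, 0 < ε₀ ∧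
      ∀ D : ClauseMix, D.T = 1 → (∃ t, D.K t = [k]) →
        ∀ n B h : ℕ → ℕ, D.IsModelSequence n B h →
          (∀ᶠ j in atTop, (h j : ℝ) ≤ C * Real.log (n j)) →
          ∀ α : ℝ, rStar k - ε₀ < α →
            ∀ m : ℕ → ℕ, (∀ j, |(m j : ℝ) - α * (n j : ℝ)| < 1) →
              Tendsto (fun j => D.unsatProb (B j) (h j) (m j)) atTop (𝓝 1)) := by
  refine ⟨fun D t₀ ht hp n B h m hs => ⟨fun hh => ?_, fun hh hm => ?_, fun _ hh hm => ?_⟩,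
    -- The conclusion of (d) holds at every positive density, so `ε₀ = rStar k` works.
    fun hk C => ⟨rStar k, rStar_pos hk, ?_⟩⟩
  · obtain ⟨H, hH⟩ := hh.bound
    have hH' : ∀ᶠ j in atTop, (h j : ℝ) ≤ H := by
      filter_upwards [hH] with j hj
      simpa using hj
    refine ⟨fun hT hm => ClauseMix.sat_whp_of_isLittleO hs hT t₀ ht hH' hm, fun hm => ?_,
      fun hm => ClauseMix.unsat_whp_of_isLittleO hs t₀ ht hp hH' hm⟩
    obtain ⟨δ, hδ, h1⟩ := ClauseMix.exists_satProb_le_of_isBigO hs t₀ ht hp hH' hm.2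
    refine ⟨⟨δ, hδ, h1⟩, fun hT => ?_⟩
    obtain ⟨δ', hδ', h2⟩ := ClauseMix.exists_le_satProb_of_isBigO hs hT t₀ ht hH' hm.1
    refine ⟨min δ δ', lt_min hδ hδ', ?_⟩
    filter_upwards [h1, h2] with j h3 h4
    exact ⟨(min_le_right _ _).trans h4, h3.trans (sub_le_sub_left (min_le_left _ _) 1)⟩
  · obtain ⟨θ, hθ⟩ := hm
    exact ClauseMix.unsat_whp_of_log_div_loglog hs t₀ ht hp hh hθ
  · obtain ⟨β, -, hβ, hm⟩ := hm
    exact ClauseMix.unsat_whp_of_exp hs t₀ ht hp hh hβ hm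
  · rintro D hT ⟨t, ht⟩ n B h hs hh α hα m hm
    rw [sub_self] at hα
    have hp : D.p t = 1 := by
      have hu : (Finset.univ : Finset (Fin D.T)) = {t} := by
        ext t'
        have := t.2
        have := t'.2
        simp only [Finset.mem_univ, Finset.mem_singleton, true_iff, Fin.ext_iff]
        omega
      rw [← D.p_sum, hu, Finset.sum_singleton]
    exact ClauseMix.unsat_whp_of_linear hs t ht (hp ▸ one_pos) hα hh hm
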